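/- Let $X$ be a compact connected Riemann surface with distinct points $x_1,\dots,x_r$ and holomorphic coordinates $z_j$ centred at $x_j$; for $\Omega\subset X$ open put $\Omega^*=\Omega\setminus\{x_1,\dots,x_r\}$. Let $H^{\mathbb C}$ be a reductive complex Lie group with maximal compact subgroup $H$ and maximal torus $T\subset H$, $\mathfrak t=\mathrm{Lie}(T)$, $\Lambda_{\mathrm{cochar}}=\ker(\exp:\mathfrak t\to T)$. For $\alpha=(\alpha_1,\dots,\alpha_r)$ with $\alpha_j\in\sqrt{-1}\,\mathfrak t$ arbitrary, let $\mathcal G_\alpha$ be the sheaf of groups whose sections over $\Omega$ are the holomorphic maps $\phi:\Omega^*\to H^{\mathbb C}$ such that, for every $x_j\in\Omega$, $|z_j(p)|^{-\alpha_j}\phi(p)|z_j(p)|^{\alpha_j}$ stays in a compact subset of $H^{\mathbb C}$ as $p\to x_j$. A parahoric bundle of weight $\alpha$ is a sheaf of (right) $\mathcal G_\alpha$-torsors. Let $\lambda=(\lambda_1,\dots,\lambda_r)$ with $\lambda_j\in\sqrt{-1}\,\mathfrak t$ and $2\pi\sqrt{-1}\,\lambda_j\in\Lambda_{\mathrm{cochar}}$.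 Choose an isomorphism $T\simeq(S^1)^k$ with components $\theta_i:S^1\to T$, let $\Theta:(\mathbb C^*)^k\to H^{\mathbb C}$ be its complexification, and let $\chi_i\in\mathfrak t$ be defined by $\theta_i(e^{2\pi\sqrt{-1}u})=\exp(u\chi_i)$. Then there are unique integers $a_{ji}$ with $\lambda_j=\sum_i\frac{\sqrt{-1}}{2\pi}a_{ji}\chi_i$. Let $\mathcal L_i=\mathcal O(\sum_j a_{ji}x_j)$, regarded as a sheaf of meromorphic functions, let $\mathcal L_i^*\subset \mathcal L_i$ be the subsheaf of nowhere vanishing sections, and $\mathcal L^*=\prod_i\mathcal L_i^*$. For every open $\Omega$ and $l\in\mathcal L^*(\Omega)$, a map $\phi:\Omega^*\to H^{\mathbb C}$ lies in $\mathcal G_\alpha(\Omega)$ if and only if $\Theta(l)\phi\,\Theta(l)^{-1}$ lies in $\mathcal G_{\alpha+\lambda}(\Omega)$. For a parahoric bundle $\mathcal E$ of weight $\alpha$ let $\mathcal E\otimes_{(\mathcal O^*)^k}\mathcal L^*$ be the sheaf quotient of $\mathcal E\times\mathcal L^*$ by $(\epsilon,l\psi)\sim(\epsilon\cdot\Theta(\psi)^{-1},l)$,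 $\psi\in(\mathcal O^*)^k$. Then these sheaves carry, functorially in $\mathcal E$, a structure of $\mathcal G_{\alpha+\lambda}$-torsor with $$(\epsilon\otimes l)\cdot\big(\Theta(l)\,\phi\,\Theta(l)^{-1}\big)=(\epsilon\cdot\phi)\otimes l ,$$ and the resulting Hecke transformation $\tau_\lambda(\mathcal E)=\mathcal E\otimes_{(\mathcal O^*)^k}\mathcal L^*$ is a natural 1–1 correspondence between parahoric bundles of weight $\alpha$ and parahoric bundles of weight $\alpha+\lambda$: it is an equivalence from the category of sheaves of $\mathcal G_\alpha$-torsors to the category of sheaves of $\mathcal G_{\alpha+\lambda}$-torsors (in particular a bijection on isomorphism classes). -/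

import Mathlib

open CategoryTheory TopologicalSpace Opposite Topology
open scoped Manifold ContDiff

universe u

noncomputable section

/-! ### Torsors under a sheaf of groups -/

/-- A sheaf of (right) torsors over a sheaf of groups `𝒢` on `X`: a sheaf of sets with a right
action of `𝒢`, compatible with restriction, which has sections locally and on whose sections
(over any open set) the action is simply transitive. -/
structure SheafTorsor {X : TopCat.{u}} (𝒢 : X.Sheaf GrpCat.{u}) where
  sheaf : X.Sheaf (Type u)
  act : ∀ {U : Opens X}, sheaf.presheaf.obj (op U) → 𝒢.presheaf.obj (op U) →
    sheaf.presheaf.obj (op U)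
  act_one : ∀ {U : Opens X} (s : sheaf.presheaf.obj (op U)), act s 1 = s
  act_mul : ∀ {U : Opens X} (s : sheaf.presheaf.obj (op U)) (g h : 𝒢.presheaf.obj (op U)),
    act s (g * h) = act (act s g) h
  act_res : ∀ {U V : Opens X} (i : U ⟶ V) (s : sheaf.presheaf.obj (op V))
    (g : 𝒢.presheaf.obj (op V)),
    sheaf.presheaf.map i.op (act s g) = act (sheaf.presheaf.map i.op s) (𝒢.presheaf.map i.op g)
  locally_nonempty : ∀ x : X, ∃ U : Opens X, x ∈ U ∧ Nonempty (sheaf.presheaf.obj (op U))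
  simply_transitive : ∀ {U : Opens X} (s t : sheaf.presheaf.obj (op U)), ∃! g, act s g = t

namespace SheafTorsor

variable {X : TopCat.{u}} {𝒢 : X.Sheaf GrpCat.{u}}

/-- A morphism of torsors is an equivariant morphism of sheaves. -/
@[ext]
structure Hom (E F : SheafTorsor 𝒢) where
  map : E.sheaf ⟶ F.sheaf
  equivariant : ∀ {U : Opens X} (s : E.sheaf.presheaf.obj (op U)) (g : 𝒢.presheaf.obj (op U)),
    map.hom.app (op U) (E.act s g) = F.act (map.hom.app (op U) s) g

instance : Category (SheafTorsor 𝒢) where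
  Hom := Hom
  id E := ⟨𝟙 _, fun _ _ => rfl⟩
  comp f g := ⟨f.map ≫ g.map, fun s h =>
    (congrArg (g.map.hom.app _) (f.equivariant s h)).trans (g.equivariant _ h)⟩

/-- The sheaf of sets underlying a torsor. -/
def forget (𝒢 : X.Sheaf GrpCat.{u}) : SheafTorsor 𝒢 ⥤ X.Sheaf (Type u) where
  obj E := E.sheaf
  map f := f.map

end SheafTorsor

namespace Parahoric

/-! ### Complex Lie groups: exponential map, reductive groups, maximal tori -/

section LieGroup

variable {E : Type*} [NormedAddCommGroup E] [NormedSpace ℂ E]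
  {G : Type u} [Group G] [TopologicalSpace G] [ChartedSpace E G]

/-- `γ : ℂ → G` is the holomorphic one-parameter subgroup of the complex Lie group `G` with
velocity `v` at the identity. -/
structure IsOneParam (v : GroupLieAlgebra 𝓘(ℂ, E) G) (γ : ℂ → G) : Prop where
  zero : γ 0 = 1
  add : ∀ s t, γ (s + t) = γ s * γ t
  holo : ContMDiff 𝓘(ℂ, ℂ) 𝓘(ℂ, E) ω γ
  deriv : (mfderiv 𝓘(ℂ, ℂ) 𝓘(ℂ, E) γ 0 (1 : ℂ) : E) = v

open Classical in
/-- The exponential map `Lie(G) → G`: the value at time `1` of the one-parameter subgroup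
with velocity `v`. -/
def lieExp (v : GroupLieAlgebra 𝓘(ℂ, E) G) : G :=
  if h : ∃ γ, IsOneParam v γ then Classical.choose h 1 else 1

/-- The (real) Lie algebra of a closed subgroup `K` of `G`: the vectors `v` with `exp (t v) ∈ K`
for all real `t`. -/
def subLie (E : Type*) [NormedAddCommGroup E] [NormedSpace ℂ E] [ChartedSpace E G]
    (K : Subgroup G) : Set (GroupLieAlgebra 𝓘(ℂ, E) G) :=
  {v | ∃ γ : ℂ → G, IsOneParam v γ ∧ ∀ t : ℝ, γ t ∈ K}

/-- `√-1 · Lie(K)` inside the complex Lie algebra of `G`. -/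
def imSubLie (E : Type*) [NormedAddCommGroup E] [NormedSpace ℂ E] [ChartedSpace E G]
    (K : Subgroup G) : Set (GroupLieAlgebra 𝓘(ℂ, E) G) :=
  {w | ∃ v ∈ subLie E K, w = Complex.I • v}

/-- The cocharacter lattice of `T`: the kernel of `exp : Lie(T) → T`. -/
def cocharLattice (E : Type*) [NormedAddCommGroup E] [NormedSpace ℂ E] [ChartedSpace E G]
    (T : Subgroup G) : Set (GroupLieAlgebra 𝓘(ℂ, E) G) :=
  {v | v ∈ subLie E T ∧ lieExp v = 1}

/-- `G` is a reductive complex Lie group with maximal compact subgroup `H`, i.e. `G` is the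
complexification of the compact group `H`: `Lie(G) = Lie(H) ⊕ √-1 Lie(H)`, and the polar
decomposition `H × Lie(H) → G`, `(h, v) ↦ h exp(√-1 v)` is a homeomorphism. -/
structure IsReductivePair (E : Type*) [NormedAddCommGroup E] [NormedSpace ℂ E]
    [ChartedSpace E G] (H : Subgroup G) : Prop where
  compact : IsCompact (H : Set G)
  decomp : ∀ w : GroupLieAlgebra 𝓘(ℂ, E) G, ∃! p : subLie E H × subLie E H,
    w = (p.1 : GroupLieAlgebra 𝓘(ℂ, E) G) + Complex.I • (p.2 : GroupLieAlgebra 𝓘(ℂ, E) G)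
  polar : IsHomeomorph (fun p : H × subLie E H =>
    (p.1 : G) * lieExp (Complex.I • (p.2 : GroupLieAlgebra 𝓘(ℂ, E) G)))

/-- `T` is a torus in `H`: for compact Lie groups `H`, tori are the compact connected
commutative subgroups. -/
structure IsTorusIn (H T : Subgroup G) : Prop where
  le : T ≤ H
  compact : IsCompact (T : Set G)
  connected : IsConnected (T : Set G)
  comm : ∀ s ∈ T, ∀ t ∈ T, s * t = t * s

/-- `T` is a maximal torus of `H`. -/
structure IsMaximalTorus (H T : Subgroup G) : Prop extends IsTorusIn H T where
  maximal : ∀ S : Subgroup G, IsTorusIn H S → T ≤ S → S = T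

/-- An isomorphism `(S¹)ᵏ ≃ T`, together with the complexification `Θ : (ℂˣ)ᵏ → G` of the
resulting homomorphism `(S¹)ᵏ → G` (the unique holomorphic homomorphism extending it). The `i`-th
component of `Θ` is the complexification of `θ_i : S¹ → G`. -/
structure TorusCoords (E : Type*) [NormedAddCommGroup E] [NormedSpace ℂ E] [ChartedSpace E G]
    (T : Subgroup G) (k : ℕ) where
  iso : (Fin k → Circle) ≃ₜ* T
  Θ : (Fin k → ℂˣ) →* G
  holo : ∀ i, ContMDiff 𝓘(ℂ, ℂ) 𝓘(ℂ, E) ω (fun z : ℂˣ => Θ (Pi.mulSingle i z))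
  extend : ∀ s : Fin k → Circle, Θ (fun i => Circle.toUnits (s i)) = (iso s : G)

/-- The vector `χ_i ∈ Lie(T)` with `θ_i(e^{2π√-1 u}) = exp(u χ_i)`, i.e. the derivative at `u = 0`
of the left-hand side. -/
def TorusCoords.chi {T : Subgroup G} {k : ℕ} (Θ : TorusCoords E T k) (i : Fin k) :
    GroupLieAlgebra 𝓘(ℂ, E) G :=
  (mfderiv 𝓘(ℂ, ℂ) 𝓘(ℂ, E) (fun w : ℂ => Θ.Θ (Pi.mulSingle i
    (Units.mk0 (Complex.exp (2 * Real.pi * Complex.I * w)) (Complex.exp_ne_zero _)))) 0 (1 : ℂ) : E)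

end LieGroup

/-! ### Marked Riemann surfaces -/

/-- Distinct points `x_1, …, x_r` of a Riemann surface, with a holomorphic coordinate `z_j`
centred at each `x_j`. -/
structure Marking (X : Type u) [TopologicalSpace X] [ChartedSpace ℂ X] (r : ℕ) where
  pt : Fin r → X
  inj : Function.Injective pt
  coord : Fin r → OpenPartialHomeomorph X ℂ
  coord_mem : ∀ j, coord j ∈ IsManifold.maximalAtlas 𝓘(ℂ, ℂ) ω X
  pt_mem : ∀ j, pt j ∈ (coord j).source
  coord_pt : ∀ j, coord j (pt j) = 0

section Surface

variable {X : Type u} [TopologicalSpace X] [T2Space X] [ChartedSpace ℂ X]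
  {r : ℕ} (D : Marking X r)

/-- `Ω* = Ω \ {x_1, …, x_r}`. -/
def Marking.punct (U : Opens X) : Opens X :=
  ⟨(U : Set X) ∩ (Set.range D.pt)ᶜ, U.isOpen.inter (Set.finite_range D.pt).isClosed.isOpen_compl⟩

theorem Marking.punct_le (U : Opens X) : D.punct U ≤ U := fun _ h => h.1

theorem Marking.punct_mono {U V : Opens X} (h : U ≤ V) : D.punct U ≤ D.punct V :=
  fun _ hx => ⟨h hx.1, hx.2⟩

variable {E : Type*} [NormedAddCommGroup E] [NormedSpace ℂ E]
  {G : Type u} [Group G] [TopologicalSpace G] [ChartedSpace E G] [LieGroup 𝓘(ℂ, E) ω G]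

/-! ### The sheaf of groups `𝒢_α` -/

/-- `t ^ v = exp (ln t · v)` for real `t > 0` and `v` in the Lie algebra of `G`. -/
def lieRpow (t : ℝ) (v : GroupLieAlgebra 𝓘(ℂ, E) G) : G :=
  lieExp ((Real.log t : ℂ) • v)

/-- `|z_j(p)|^{-α_j} φ(p) |z_j(p)|^{α_j}` stays in a compact subset of `G` as `p → x_j`. -/
def BoundedAt (α : Fin r → GroupLieAlgebra 𝓘(ℂ, E) G) {U : Opens X} (φ : D.punct U → G)
    (j : Fin r) : Prop :=
  ∃ K : Set G, IsCompact K ∧ ∀ᶠ p in 𝓝[≠] (D.pt j), ∀ hp : p ∈ D.punct U,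
    (lieRpow ‖D.coord j p‖ (α j))⁻¹ * φ ⟨p, hp⟩ * lieRpow ‖D.coord j p‖ (α j) ∈ K

/-- The group `𝒢_α(U)`: holomorphic maps `φ : U* → G` with `|z_j|^{-α_j} φ |z_j|^{α_j}` bounded
near each `x_j ∈ U`. -/
def parahoricSections (α : Fin r → GroupLieAlgebra 𝓘(ℂ, E) G) (U : Opens X) :
    Subgroup (D.punct U → G) where
  carrier := {φ | ContMDiff 𝓘(ℂ, ℂ) 𝓘(ℂ, E) ω φ ∧ ∀ j, D.pt j ∈ U → BoundedAt D α φ j}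
  one_mem' := ⟨contMDiff_const, fun j _ => ⟨{1}, isCompact_singleton,
    Filter.Eventually.of_forall fun p hp => by simp⟩⟩
  mul_mem' := by
    rintro φ ψ ⟨hφ, hφ'⟩ ⟨hψ, hψ'⟩
    have := topologicalGroup_of_lieGroup 𝓘(ℂ, E) (G := G) ω
    refine ⟨hφ.mul hψ, fun j hj => ?_⟩
    obtain ⟨K, hK, h1⟩ := hφ' j hj
    obtain ⟨L, hL, h2⟩ := hψ' j hj
    refine ⟨(fun q : G × G => q.1 * q.2) '' (K ×ˢ L), (hK.prod hL).image continuous_mul, ?_⟩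
    filter_upwards [h1, h2] with p hp1 hp2 hp
    exact ⟨(_, _), ⟨hp1 hp, hp2 hp⟩, by simp only [Pi.mul_apply]; group⟩
  inv_mem' := by
    rintro φ ⟨hφ, hφ'⟩
    have := topologicalGroup_of_lieGroup 𝓘(ℂ, E) (G := G) ω
    refine ⟨hφ.inv, fun j hj => ?_⟩
    obtain ⟨K, hK, h1⟩ := hφ' j hj
    refine ⟨(fun q : G => q⁻¹) '' K, hK.image continuous_inv, ?_⟩
    filter_upwards [h1] with p hp1 hp
    exact ⟨_, hp1 hp, by simp only [Pi.inv_apply]; group⟩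

theorem parahoricSections_restrict (α : Fin r → GroupLieAlgebra 𝓘(ℂ, E) G) {U V : Opens X}
    (h : U ≤ V) {φ : D.punct V → G} (hφ : φ ∈ parahoricSections D α V) :
    φ ∘ Set.inclusion (D.punct_mono h) ∈ parahoricSections D α U := by
  refine ⟨hφ.1.comp (contMDiff_inclusion (D.punct_mono h)), fun j hj => ?_⟩
  obtain ⟨K, hK, h1⟩ := hφ.2 j (h hj)
  refine ⟨K, hK, ?_⟩
  filter_upwards [h1] with p hp1 hp
  exact hp1 (D.punct_mono h hp)

/-- The presheaf of groups `U ↦ 𝒢_α(U)`. -/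
def parahoricPresheaf (α : Fin r → GroupLieAlgebra 𝓘(ℂ, E) G) :
    TopCat.Presheaf GrpCat.{u} (TopCat.of X) where
  obj U := GrpCat.of (parahoricSections D α U.unop)
  map i := GrpCat.ofHom
    { toFun := fun φ => ⟨_, parahoricSections_restrict D α i.unop.le φ.2⟩
      map_one' := rfl
      map_mul' := fun _ _ => rfl }
  map_id _ := rfl
  map_comp _ _ := rfl

/-- Local nature of the conditions defining `𝒢_α`. -/
theorem parahoricSections_local (α : Fin r → GroupLieAlgebra 𝓘(ℂ, E) G) {ι : Type*}
    (U : ι → Opens X) (φ : D.punct (iSup U) → G)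
    (h : ∀ i, φ ∘ Set.inclusion (D.punct_mono (le_iSup U i)) ∈ parahoricSections D α (U i)) :
    φ ∈ parahoricSections D α (iSup U) := by
  refine ⟨?_, fun j hj => ?_⟩
  · refine ((contDiffWithinAt_localInvariantProp (I := 𝓘(ℂ, ℂ)) (I' := 𝓘(ℂ, E)) ω).localPredicate
      X G).locality (U := D.punct (iSup U)) φ fun x => ?_
    obtain ⟨i, hi⟩ := Opens.mem_iSup.1 x.2.1
    exact ⟨D.punct (U i), ⟨hi, x.2.2⟩, homOfLE (D.punct_mono (le_iSup U i)), (h i).1⟩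
  · obtain ⟨i, hi⟩ := Opens.mem_iSup.1 hj
    obtain ⟨K, hK, h1⟩ := (h i).2 j hi
    refine ⟨K, hK, ?_⟩
    filter_upwards [h1, mem_nhdsWithin_of_mem_nhds ((U i).isOpen.mem_nhds hi)] with p hp1 hpi hp
    exact hp1 ⟨hpi, hp.2⟩

theorem parahoricPresheaf_isSheaf (α : Fin r → GroupLieAlgebra 𝓘(ℂ, E) G) :
    (parahoricPresheaf D α).IsSheaf := by
  rw [TopCat.Presheaf.IsSheaf, CategoryTheory.Presheaf.isSheaf_iff_isSheaf_forget _ _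
    (CategoryTheory.forget GrpCat)]
  refine TopCat.Presheaf.isSheaf_of_isSheafUniqueGluing_types _ ?_
  intro ι U sf hsf
  have key : ∀ (i j : ι) (p : X) (hi : p ∈ D.punct (U i)) (hj : p ∈ D.punct (U j)),
      (sf i).1 ⟨p, hi⟩ = (sf j).1 ⟨p, hj⟩ := by
    intro i j p hi hj
    have := congrArg (fun s => s.1 ⟨p, ⟨hi.1, hj.1⟩, hi.2⟩) (hsf i j)
    exact this
  have ex : ∀ p : D.punct (iSup U), ∃ i, p.1 ∈ D.punct (U i) := fun p => by
    obtain ⟨i, hi⟩ := Opens.mem_iSup.1 p.2.1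
    exact ⟨i, hi, p.2.2⟩
  choose c hc using ex
  let φ : D.punct (iSup U) → G := fun p => (sf (c p)).1 ⟨p.1, hc p⟩
  have hφ : ∀ i, φ ∘ Set.inclusion (D.punct_mono (le_iSup U i)) = (sf i).1 := fun i => by
    funext p
    exact key _ _ _ _ _
  refine ⟨⟨φ, parahoricSections_local D α U φ fun i => by rw [hφ i]; exact (sf i).2⟩,
    fun i => Subtype.ext (hφ i), fun t ht => Subtype.ext ?_⟩
  funext p
  have := congrArg (fun s => s.1 ⟨p.1, hc p⟩) (ht (c p))
  exact this

/-- The sheaf of groups `𝒢_α` on `X`. -/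
def parahoricSheaf (α : Fin r → GroupLieAlgebra 𝓘(ℂ, E) G) :
    TopCat.Sheaf GrpCat.{u} (TopCat.of X) :=
  ⟨parahoricPresheaf D α, parahoricPresheaf_isSheaf D α⟩

/-- Parahoric bundles of weight `α`: sheaves of `𝒢_α`-torsors. -/
abbrev ParahoricBundle (α : Fin r → GroupLieAlgebra 𝓘(ℂ, E) G) : Type _ :=
  SheafTorsor (parahoricSheaf D α)

/-! ### The sheaf `ℒ*` and the Hecke transformation -/

variable {k : ℕ}

/-- `ℒ*(U) = ∏_i ℒ_i*(U)`, where `ℒ_i = 𝒪(∑_j a_{ji} x_j)`: a nowhere vanishing section of `ℒ_i`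
over `U` is a nowhere vanishing holomorphic function on `U*` which at each `x_j ∈ U` has
order exactly `-a_{ji}`, i.e. is `z_j^{-a_{ji}}` times a nonvanishing holomorphic function.
The canonical section `σ_i` of `ℒ_i` is the constant function `1`. -/
def LStar (a : Fin r → Fin k → ℤ) (U : Opens X) : Type u :=
  {l : D.punct U → Fin k → ℂˣ //
    (∀ i, ContMDiff 𝓘(ℂ, ℂ) 𝓘(ℂ, ℂ) ω (fun p => l p i)) ∧
    ∀ i j, D.pt j ∈ U → ∃ g : ℂ → ℂ, AnalyticAt ℂ g 0 ∧ g 0 ≠ 0 ∧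
      ∀ᶠ p in 𝓝[≠] (D.pt j), ∀ hp : p ∈ D.punct U,
        (l ⟨p, hp⟩ i : ℂ) = D.coord j p ^ (-a j i) * g (D.coord j p)}

/-- Restriction of sections of `ℒ*`. -/
def LStar.res {a : Fin r → Fin k → ℤ} {U V : Opens X} (h : U ≤ V) (l : LStar D a V) :
    LStar D a U :=
  ⟨l.1 ∘ Set.inclusion (D.punct_mono h),
    fun i => (l.2.1 i).comp (contMDiff_inclusion (D.punct_mono h)),
    fun i j hj => by
      obtain ⟨g, hg, hg0, hg'⟩ := l.2.2 i j (h hj)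
      refine ⟨g, hg, hg0, ?_⟩
      filter_upwards [hg'] with p hp1 hp
      exact hp1 (D.punct_mono h hp)⟩

variable {D} {T : Subgroup G} {α : Fin r → GroupLieAlgebra 𝓘(ℂ, E) G}

/-- The relation on `ℰ(U) × ℒ*(U)` which identifies `(ε, l ψ)` with `(ε · Θ(ψ)⁻¹, l)`, for
`ψ ∈ 𝒪*(U)ᵏ`. -/
def heckeRel (Θ : TorusCoords E T k) (a : Fin r → Fin k → ℤ) (ℰ : ParahoricBundle D α)
    (U : Opens X) (s t : ℰ.sheaf.presheaf.obj (op U) × LStar D a U) : Prop :=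
  ∃ (ψ : U → Fin k → ℂˣ) (g : parahoricSections D α U),
    (∀ i, ContMDiff 𝓘(ℂ, ℂ) 𝓘(ℂ, ℂ) ω (fun p => ψ p i)) ∧
    (∀ p : D.punct U, g.1 p = Θ.Θ (ψ ⟨p.1, D.punct_le U p.2⟩)) ∧
    (∀ p : D.punct U, s.2.1 p = t.2.1 p * ψ ⟨p.1, D.punct_le U p.2⟩) ∧
    t.1 = ℰ.act s.1 (g⁻¹)

/-- The presheaf `U ↦ (ℰ(U) × ℒ*(U)) / 𝒪*(U)ᵏ`. -/
def heckePresheaf (Θ : TorusCoords E T k) (a : Fin r → Fin k → ℤ) (ℰ : ParahoricBundle D α) :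
    TopCat.Presheaf (Type u) (TopCat.of X) where
  obj U := Quot (heckeRel Θ a ℰ U.unop)
  map {U V} i := ↾(Quot.map
    (fun s => (ℰ.sheaf.presheaf.map i s.1, LStar.res D i.unop.le s.2)) (by
      rintro s t ⟨ψ, g, h1, h2, h3, h4⟩
      refine ⟨ψ ∘ Set.inclusion i.unop.le, ⟨_, parahoricSections_restrict D α i.unop.le g.2⟩,
        fun j => (h1 j).comp (contMDiff_inclusion i.unop.le), fun p => h2 _, fun p => h3 _, ?_⟩
      dsimp only
      rw [h4]
      exact ℰ.act_res i.unop s.1 g⁻¹))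
  map_id U := by
    ext s
    induction s using Quot.ind with | mk s => ?_
    have : ℰ.sheaf.presheaf.map (𝟙 U) s.1 = s.1 := by simp
    exact congrArg (Quot.mk _) (Prod.ext this rfl)
  map_comp i j := by
    ext s
    induction s using Quot.ind with | mk s => ?_
    have : ℰ.sheaf.presheaf.map (i ≫ j) s.1
      = ℰ.sheaf.presheaf.map j (ℰ.sheaf.presheaf.map i s.1) := by simp
    exact congrArg (Quot.mk _) (Prod.ext this rfl)

/-- Functoriality in `ℰ` of `U ↦ (ℰ(U) × ℒ*(U)) / 𝒪*(U)ᵏ`. -/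
def heckePresheafFunctor (Θ : TorusCoords E T k) (a : Fin r → Fin k → ℤ) :
    ParahoricBundle D α ⥤ TopCat.Presheaf (Type u) (TopCat.of X) where
  obj ℰ := heckePresheaf Θ a ℰ
  map {ℰ ℱ} f :=
    { app := fun U => ↾(Quot.map
        (fun s => (f.map.hom.app U s.1, s.2)) (by
          rintro s t ⟨ψ, g, h1, h2, h3, h4⟩
          refine ⟨ψ, g, h1, h2, h3, ?_⟩
          dsimp only
          rw [h4]
          exact f.equivariant s.1 g⁻¹))
      naturality := fun U V i => by
        ext s
        induction s using Quot.ind with | mk s => ?_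
        have := NatTrans.naturality_apply f.map.hom i s.1
        exact congrArg (Quot.mk _) (Prod.ext this rfl) }
  map_id ℰ := by
    ext U s
    induction s using Quot.ind with | mk s => ?_
    rfl
  map_comp f g := by
    ext U s
    induction s using Quot.ind with | mk s => ?_
    rfl

/-- The sheaf of sets `ℰ ⊗_{(𝒪*)ᵏ} ℒ*`, functorially in the parahoric bundle `ℰ`: the
sheafification of `U ↦ (ℰ(U) × ℒ*(U)) / 𝒪*(U)ᵏ`. -/
def heckeSheaf (Θ : TorusCoords E T k) (a : Fin r → Fin k → ℤ) :
    ParahoricBundle D α ⥤ TopCat.Sheaf (Type u) (TopCat.of X) :=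
  heckePresheafFunctor Θ a ⋙ presheafToSheaf (Opens.grothendieckTopology X) (Type u)

/-- The section `ε ⊗ l` of `ℰ ⊗_{(𝒪*)ᵏ} ℒ*`. -/
def tmul (Θ : TorusCoords E T k) {a : Fin r → Fin k → ℤ} (ℰ : ParahoricBundle D α) {U : Opens X}
    (ε : ℰ.sheaf.presheaf.obj (op U)) (l : LStar D a U) :
    ((heckeSheaf Θ a).obj ℰ).presheaf.obj (op U) :=
  (toSheafify (Opens.grothendieckTopology X) (heckePresheaf Θ a ℰ)).app (op U)
    (Quot.mk _ (ε, l))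

variable (D) in
/-- The Hecke transformation with exponents `a`: the sheaf `ℰ ⊗_{(𝒪*)ᵏ} ℒ*`, naturally in `ℰ`,
made into a `𝒢_β`-torsor by `(ε ⊗ l) · (Θ(l) φ Θ(l)⁻¹) = (ε · φ) ⊗ l`. Here the twisted sheaf of
groups `ℒ* ⊗_Ad 𝒢_α` is embedded into the meromorphic maps to `G` by `[l, φ] ↦ Θ(l) φ Θ(l)⁻¹`.
As every section of `ℰ ⊗ ℒ*` is locally of the form `ε ⊗ l`, the rule determines the action when
conjugation by `Θ(l)` carries `𝒢_α` onto `𝒢_β`. -/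
structure HeckeTransformation (Θ : TorusCoords E T k) (a : Fin r → Fin k → ℤ)
    (α β : Fin r → GroupLieAlgebra 𝓘(ℂ, E) G) where
  functor : ParahoricBundle D α ⥤ ParahoricBundle D β
  iso : functor ⋙ SheafTorsor.forget (parahoricSheaf D β) ≅ heckeSheaf Θ a
  act_tmul : ∀ (ℰ : ParahoricBundle D α) (U : Opens X) (ε : ℰ.sheaf.presheaf.obj (op U))
    (l : LStar D a U) (φ : parahoricSections D α U) (μ : parahoricSections D β U),
    (∀ p, μ.1 p = Θ.Θ (l.1 p) * φ.1 p * (Θ.Θ (l.1 p))⁻¹) →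
    (functor.obj ℰ).act ((iso.inv.app ℰ).hom.app (op U) (tmul Θ ℰ ε l)) μ =
      (iso.inv.app ℰ).hom.app (op U) (tmul Θ ℰ (ℰ.act ε φ) l)

end Surface

end Parahoric

end

/-!
Why the Hecke transformation exists and is an equivalence.

*Lie theory.* In the chart at `1`, a holomorphic one-parameter subgroup solves the ordinary
differential equation of a left-invariant vector field, so it is determined by its velocity
(`IsOneParam.unique`); this makes `lieExp` computable. In particular
`w ↦ Θ(e^{c_1 w}, …, e^{c_k w})` is the one-parameter subgroup with velocity `∑ c_i/(2π√-1) χ_i`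
(`TorusCoords.isOneParam_exp`). If `v` is in the cocharacter lattice, then `t ↦ exp(t v)` is, in
the coordinates of `T`, a `k`-tuple of continuous homomorphisms `ℝ → S¹` of period `1`, that is,
of characters `e^{2π√-1 n_i t}`. This gives the existence and uniqueness of the exponents `a_{ji}`
(`TorusCoords.existsUnique_coeff`). Moreover, `t^{α + λ} = t^α · Θ(t^{-a})`, where `t^α`
commutes with the image of `Θ`. As a section `l` of `ℒ*` is `|z_j|^{-a_j}` near `x_j` up to a
factor in a compact set, conjugation by `Θ(l)` carries `𝒢_α` onto `𝒢_{α+λ}`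
(`TorusCoords.conj_mem_iff`).

*Torsors.* The rest is formal. The sheaf `ℒ*` has local sections, conjugation by `Θ(l)` is an
isomorphism `𝒢_α ≃ 𝒢_{α+λ}` wherever `l` is defined, and two such isomorphisms differ by the inner
automorphism of `Θ(l⁻¹ l')`, which is a section of `𝒢_α` since `l⁻¹ l'` extends holomorphically
over the marked points. Such data (`SheafTorsor.Twist`) turn a `𝒢`-torsor `E` into a `𝒢'`-torsor,
whose sections are the families `l ↦ ε_l` of sections of `E` with `ε_{l'} = ε_l · Θ(l⁻¹ l')`; the
family stands for `ε_l ⊗ l`. The data can be inverted, and twisting back and forth is naturally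
isomorphic to the identity because every morphism of torsors is an isomorphism
(`SheafTorsor.Twist.functor_isEquivalence`). The map `ε ⊗ l ↦ (l' ↦ ε · Θ(l⁻¹ l'))` from the
presheaf quotient `(ℰ × ℒ*)/(𝒪*)ᵏ` to the twist is locally bijective, so the twist is the sheaf
`ℰ ⊗ ℒ*` (`TorusCoords.isIso_heckeSheafHom`). Finally, sections of `ℰ ⊗ ℒ*` are locally of the
form `ε ⊗ l`, so the torsor structure is forced by its values there and every Hecke transformation
is isomorphic to the twist (`HeckeTransformation.nonempty_iso`).
-/

noncomputable section

namespace SheafTorsor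

/-! ### Restriction and gluing of sections of torsors -/

section Restriction

variable {X : TopCat.{u}} {𝒢 : X.Sheaf GrpCat.{u}}

/-- The sections over `U` of a sheaf of groups. -/
abbrev GrpSec (𝒢 : X.Sheaf GrpCat.{u}) (U : Opens X) : Type u := 𝒢.presheaf.obj (op U)

/-- The sections over `U` of a torsor. -/
abbrev Sec (E : SheafTorsor 𝒢) (U : Opens X) : Type u := E.sheaf.presheaf.obj (op U)

/-- Restriction of sections of a sheaf of groups, as a group homomorphism. -/
def gres (𝒢 : X.Sheaf GrpCat.{u}) {U V : Opens X} (h : V ≤ U) : GrpSec 𝒢 U →* GrpSec 𝒢 V :=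
  (𝒢.presheaf.map (homOfLE h).op).hom

/-- Restriction of sections of a torsor. -/
def res (E : SheafTorsor 𝒢) {U V : Opens X} (h : V ≤ U) (s : E.Sec U) : E.Sec V :=
  E.sheaf.presheaf.map (homOfLE h).op s

theorem gres_gres {U V W : Opens X} (h : V ≤ U) (h' : W ≤ V) (g : GrpSec 𝒢 U) :
    gres 𝒢 h' (gres 𝒢 h g) = gres 𝒢 (h'.trans h) g := by
  have : 𝒢.presheaf.map (homOfLE (h'.trans h)).op
      = 𝒢.presheaf.map (homOfLE h).op ≫ 𝒢.presheaf.map (homOfLE h').op := by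
    rw [← Functor.map_comp]; rfl
  unfold gres
  rw [this]
  rfl

theorem res_res (E : SheafTorsor 𝒢) {U V W : Opens X} (h : V ≤ U) (h' : W ≤ V) (s : E.Sec U) :
    E.res h' (E.res h s) = E.res (h'.trans h) s := by
  have : E.sheaf.presheaf.map (homOfLE (h'.trans h)).op
      = E.sheaf.presheaf.map (homOfLE h).op ≫ E.sheaf.presheaf.map (homOfLE h').op := by
    rw [← Functor.map_comp]; rfl
  unfold res
  rw [this]
  rfl

theorem res_self (E : SheafTorsor 𝒢) {U : Opens X} (h : U ≤ U) (s : E.Sec U) :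
    E.res h s = s := by
  have : E.sheaf.presheaf.map (homOfLE h).op = 𝟙 _ := E.sheaf.presheaf.map_id _
  unfold res
  rw [this]
  rfl

theorem res_act (E : SheafTorsor 𝒢) {U V : Opens X} (h : V ≤ U) (s : E.Sec U)
    (g : GrpSec 𝒢 U) : E.res h (E.act s g) = E.act (E.res h s) (gres 𝒢 h g) :=
  E.act_res (homOfLE h) s g

theorem act_cancel (E : SheafTorsor 𝒢) {U : Opens X} (s : E.Sec U) {g h : GrpSec 𝒢 U}
    (e : E.act s g = E.act s h) : g = h :=
  (E.simply_transitive s (E.act s h)).unique e rfl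

theorem sec_ext (E : SheafTorsor 𝒢) {U : Opens X} {s t : E.Sec U}
    (h : ∀ x ∈ U, ∃ (V : Opens X) (hV : V ≤ U), x ∈ V ∧ E.res hV s = E.res hV t) : s = t := by
  choose V hV hx e using fun x : U => h x.1 x.2
  exact TopCat.Sheaf.eq_of_locally_eq' E.sheaf V U (fun x => homOfLE (hV x))
    (fun x hx' => Opens.mem_iSup.2 ⟨⟨x, hx'⟩, hx _⟩) s t e

theorem grpSec_ext {U : Opens X} {s t : GrpSec 𝒢 U}
    (h : ∀ x ∈ U, ∃ (V : Opens X) (hV : V ≤ U), x ∈ V ∧ gres 𝒢 hV s = gres 𝒢 hV t) : s = t := by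
  choose V hV hx e using fun x : U => h x.1 x.2
  exact TopCat.Sheaf.eq_of_locally_eq' 𝒢 V U (fun x => homOfLE (hV x))
    (fun x hx' => Opens.mem_iSup.2 ⟨⟨x, hx'⟩, hx _⟩) s t e

theorem grpSec_glue {ι : Type*} {U : Opens X} (V : ι → Opens X) (hV : ∀ i, V i ≤ U)
    (hcov : ∀ x ∈ U, ∃ i, x ∈ V i) (s : ∀ i, GrpSec 𝒢 (V i))
    (h : ∀ i j, gres 𝒢 (inf_le_left : V i ⊓ V j ≤ V i) (s i) = gres 𝒢 inf_le_right (s j)) :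
    ∃ t : GrpSec 𝒢 U, ∀ i, gres 𝒢 (hV i) t = s i :=
  (TopCat.Sheaf.existsUnique_gluing' 𝒢 V U (fun i => homOfLE (hV i))
    (fun x hx => Opens.mem_iSup.2 (hcov x hx)) s h).exists

theorem sec_glue (E : SheafTorsor 𝒢) {ι : Type*} {U : Opens X} (V : ι → Opens X)
    (hV : ∀ i, V i ≤ U) (hcov : ∀ x ∈ U, ∃ i, x ∈ V i) (s : ∀ i, E.Sec (V i))
    (h : ∀ i j, E.res (inf_le_left : V i ⊓ V j ≤ V i) (s i) = E.res inf_le_right (s j)) :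
    ∃ t : E.Sec U, ∀ i, E.res (hV i) t = s i := by
  have h' : TopCat.Presheaf.IsCompatible E.sheaf.presheaf V s := h
  exact (TopCat.Sheaf.existsUnique_gluing' E.sheaf V U (fun i => homOfLE (hV i))
    (fun x hx => Opens.mem_iSup.2 (hcov x hx)) s h').exists

/-- The effect of a morphism of torsors on sections. -/
def Hom.onSec {E F : SheafTorsor 𝒢} (f : Hom E F) {U : Opens X} (s : E.Sec U) : F.Sec U :=
  f.map.hom.app (op U) s

theorem Hom.onSec_act {E F : SheafTorsor 𝒢} (f : Hom E F) {U : Opens X} (s : E.Sec U)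
    (g : GrpSec 𝒢 U) : f.onSec (E.act s g) = F.act (f.onSec s) g :=
  f.equivariant s g

theorem Hom.onSec_res {E F : SheafTorsor 𝒢} (f : Hom E F) {U V : Opens X} (h : V ≤ U)
    (s : E.Sec U) : f.onSec (E.res h s) = F.res h (f.onSec s) :=
  NatTrans.naturality_apply f.map.hom (homOfLE h).op s

/-- Equivariance of a morphism between the sheaves underlying two torsors is a local property. -/
theorem equivariant_of_local {E F : SheafTorsor 𝒢} (m : E.sheaf ⟶ F.sheaf)
    (h : ∀ {U : Opens X} (s : E.Sec U) (g : GrpSec 𝒢 U), ∀ x ∈ U, ∃ (V : Opens X) (hV : V ≤ U),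
      x ∈ V ∧ m.hom.app (op V) (E.act (E.res hV s) (gres 𝒢 hV g))
        = F.act (m.hom.app (op V) (E.res hV s)) (gres 𝒢 hV g))
    {U : Opens X} (s : E.Sec U) (g : GrpSec 𝒢 U) :
    m.hom.app (op U) (E.act s g) = F.act (m.hom.app (op U) s) g := by
  refine F.sec_ext fun x hx => ?_
  obtain ⟨V, hV, hxV, e⟩ := h s g x hx
  have nat : ∀ t : E.Sec U, m.hom.app (op V) (E.res hV t) = F.res hV (m.hom.app (op U) t) :=
    fun t => NatTrans.naturality_apply m.hom (homOfLE hV).op t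
  refine ⟨V, hV, hxV, ?_⟩
  rw [F.res_act, ← nat, ← nat, E.res_act, e]

/-- A morphism of torsors is bijective over every open set. Surjectivity is a local question, and
locally both sides have sections. -/
theorem Hom.onSec_bijective {E F : SheafTorsor 𝒢} (f : Hom E F) (U : Opens X) :
    Function.Bijective (f.onSec (U := U)) := by
  have inj : ∀ U, Function.Injective (f.onSec (U := U)) := by
    intro U s t e
    obtain ⟨g, rfl, -⟩ := E.simply_transitive s t
    rw [f.onSec_act] at e
    have : g = 1 := F.act_cancel (f.onSec s) (by rw [← e, F.act_one])
    rw [this, E.act_one]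
  refine ⟨inj U, fun t => ?_⟩
  -- preimages exist where `E` has sections; they glue by injectivity
  choose W hxW s using fun x : U => E.locally_nonempty x.1
  have surj : ∀ x : U, ∃ s' : E.Sec (W x ⊓ U), f.onSec s' = F.res inf_le_right t := by
    intro x
    obtain ⟨g, hg, -⟩ := F.simply_transitive (f.onSec (E.res inf_le_left (s x).some))
      (F.res (inf_le_right : W x ⊓ U ≤ U) t)
    exact ⟨E.act (E.res inf_le_left (s x).some) g, by rw [f.onSec_act, hg]⟩
  choose s' hs' using surj
  obtain ⟨r, hr⟩ := E.sec_glue (fun x : U => W x ⊓ U) (fun _ => inf_le_right)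
    (fun x hx => ⟨⟨x, hx⟩, hxW _, hx⟩) s' fun i j => by
      apply inj
      rw [f.onSec_res, f.onSec_res, hs', hs', F.res_res, F.res_res]
  refine ⟨r, F.sec_ext fun x hx => ⟨W ⟨x, hx⟩ ⊓ U, inf_le_right, ⟨hxW _, hx⟩, ?_⟩⟩
  rw [← f.onSec_res, hr, hs']

/-- Every morphism of torsors is an isomorphism. -/
theorem Hom.isIso {E F : SheafTorsor 𝒢} (f : E ⟶ F) : IsIso f := by
  have : IsIso ((sheafToPresheaf (Opens.grothendieckTopology X) (Type u)).map (Hom.map f)) := by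
    rw [NatTrans.isIso_iff_isIso_app]
    intro U
    rw [isIso_iff_bijective]
    exact Hom.onSec_bijective f U.unop
  have : IsIso (Hom.map f) := 
    (fullyFaithfulSheafToPresheaf (Opens.grothendieckTopology X) (Type u)).isIso_of_isIso_map
      (Hom.map f)
  let g : F ⟶ E := ⟨inv (Hom.map f), fun {U} s h => by
    apply (Hom.onSec_bijective f U).1
    have key : ∀ t : F.Sec U, Hom.onSec f ((inv (Hom.map f)).hom.app (op U) t) = t := fun t =>
      congrArg (fun q : F.sheaf ⟶ F.sheaf => q.hom.app (op U) t) (IsIso.inv_hom_id (Hom.map f))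
    rw [Hom.onSec_act, key, key]⟩
  exact ⟨g, Hom.ext (IsIso.hom_inv_id (Hom.map f)), Hom.ext (IsIso.inv_hom_id (Hom.map f))⟩

end Restriction

end SheafTorsor

namespace SheafTorsor

/-! ### Twisting torsors by a local identification of two sheaves of groups -/

section Twist

variable {X : TopCat.{u}} {𝒢 𝒢' : X.Sheaf GrpCat.{u}}

/-- Local identifications of two sheaves of groups `𝒢` and `𝒢'` which differ by inner
automorphisms: a presheaf of sets `L` with local sections, an isomorphism `conj l : 𝒢|_U ≃ 𝒢'|_U`
for every `l ∈ L(U)`, and sections `trans l l'` of `𝒢` that form a cocycle and compare `conj l`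
with `conj l'`. Such data amount to a `𝒢'`-`𝒢`-bitorsor. -/
structure Twist (𝒢 𝒢' : X.Sheaf GrpCat.{u}) where
  L : Opens X → Type u
  res : ∀ {U V : Opens X}, V ≤ U → L U → L V
  res_res : ∀ {U V W : Opens X} (h : V ≤ U) (h' : W ≤ V) (l : L U),
    res h' (res h l) = res (h'.trans h) l
  res_self : ∀ {U : Opens X} (h : U ≤ U) (l : L U), res h l = l
  conj : ∀ {U : Opens X}, L U → (GrpSec 𝒢 U ≃* GrpSec 𝒢' U)
  trans : ∀ {U : Opens X}, L U → L U → GrpSec 𝒢 U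
  conj_res : ∀ {U V : Opens X} (h : V ≤ U) (l : L U) (φ : GrpSec 𝒢 U),
    gres 𝒢' h (conj l φ) = conj (res h l) (gres 𝒢 h φ)
  trans_res : ∀ {U V : Opens X} (h : V ≤ U) (l l' : L U),
    gres 𝒢 h (trans l l') = trans (res h l) (res h l')
  trans_mul : ∀ {U : Opens X} (l l' l'' : L U), trans l l' * trans l' l'' = trans l l''
  conj_trans : ∀ {U : Opens X} (l l' : L U) (φ : GrpSec 𝒢 U),
    conj l' φ = conj l (trans l l' * φ * trans l' l)
  exists_mem : ∀ x : X, ∃ U : Opens X, x ∈ U ∧ Nonempty (L U)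

namespace Twist

theorem trans_self (t : Twist 𝒢 𝒢') {U : Opens X} (l : t.L U) : t.trans l l = 1 := by
  simpa using t.trans_mul l l l

theorem trans_inv (t : Twist 𝒢 𝒢') {U : Opens X} (l l' : t.L U) :
    (t.trans l l')⁻¹ = t.trans l' l :=
  inv_eq_of_mul_eq_one_right (by rw [t.trans_mul, t.trans_self])

theorem conj_symm_conj (t : Twist 𝒢 𝒢') {U : Opens X} (l l' : t.L U) (φ : GrpSec 𝒢 U) :
    (t.conj l').symm (t.conj l φ) = t.trans l' l * φ * t.trans l l' := by
  rw [MulEquiv.symm_apply_eq, t.conj_trans l l']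
  congr 1
  simp only [← t.trans_inv l l']
  group

theorem conj_symm_trans (t : Twist 𝒢 𝒢') {U : Opens X} (l l' : t.L U) (μ : GrpSec 𝒢' U) :
    t.trans l l' * (t.conj l').symm μ = (t.conj l).symm μ * t.trans l l' := by
  obtain ⟨φ, rfl⟩ := (t.conj l).surjective μ
  rw [t.conj_symm_conj, MulEquiv.symm_apply_apply, ← t.trans_inv l l']
  group

theorem conj_symm_res (t : Twist 𝒢 𝒢') {U V : Opens X} (h : V ≤ U) (l : t.L U)
    (μ : GrpSec 𝒢' U) :
    gres 𝒢 h ((t.conj l).symm μ) = (t.conj (t.res h l)).symm (gres 𝒢' h μ) := by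
  obtain ⟨φ, rfl⟩ := (t.conj l).surjective μ
  rw [t.conj_res, MulEquiv.symm_apply_apply, MulEquiv.symm_apply_apply]

theorem exists_le (t : Twist 𝒢 𝒢') {U : Opens X} {x : X} (hx : x ∈ U) :
    ∃ V : Opens X, V ≤ U ∧ x ∈ V ∧ Nonempty (t.L V) := by
  obtain ⟨V, hV, ⟨l⟩⟩ := t.exists_mem x
  exact ⟨V ⊓ U, inf_le_right, ⟨hV, hx⟩, ⟨t.res inf_le_left l⟩⟩

/-- The inverse identifications, from `𝒢'` to `𝒢`. -/
def symm (t : Twist 𝒢 𝒢') : Twist 𝒢' 𝒢 where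
  L := t.L
  res := t.res
  res_res := t.res_res
  res_self := t.res_self
  conj l := (t.conj l).symm
  trans l l' := t.conj l (t.trans l' l)
  conj_res h l φ := t.conj_symm_res h l φ
  trans_res h l l' := by rw [t.conj_res, t.trans_res]
  trans_mul l l' l'' := by
    rw [t.conj_trans l l', ← map_mul]
    congr 1
    rw [mul_assoc (t.trans l l'), t.trans_mul l'' l' l, ← mul_assoc, t.trans_mul, t.trans_self,
      one_mul]
  conj_trans l l' φ := by
    obtain ⟨φ, rfl⟩ := (t.conj l).surjective φ
    rw [t.conj_symm_conj, t.conj_trans l l' (t.trans l l'), ← map_mul, ← map_mul,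
      MulEquiv.symm_apply_apply, mul_assoc (t.trans l l'), t.trans_mul, t.trans_self, mul_one]
  exists_mem := t.exists_mem

/-- A section over `U` of the twist of a torsor `E`: a family of sections `val V l ∈ E(V)`, for
`V ⊆ U` and `l ∈ L(V)`, which is compatible with restriction and transforms by the cocycle. With
`val V l = ε` such a family stands for `ε ⊗ l`. -/
@[ext]
structure Fam (t : Twist 𝒢 𝒢') (E : SheafTorsor 𝒢) (U : Opens X) : Type u where
  val : ∀ V : Opens X, V ≤ U → t.L V → E.Sec V
  val_res : ∀ {V W : Opens X} (hV : V ≤ U) (hW : W ≤ V) (l : t.L V),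
    E.res hW (val V hV l) = val W (hW.trans hV) (t.res hW l)
  val_trans : ∀ {V : Opens X} (hV : V ≤ U) (l l' : t.L V),
    val V hV l' = E.act (val V hV l) (t.trans l l')

variable (t : Twist 𝒢 𝒢') (E : SheafTorsor 𝒢)

/-- Two sections of a twist agree if they agree on one section of `L` around each point. -/
theorem Fam.ext_local {t : Twist 𝒢 𝒢'} {E : SheafTorsor 𝒢} {U : Opens X} {s s' : t.Fam E U}
    (h : ∀ x ∈ U, ∃ (V : Opens X) (hV : V ≤ U) (l : t.L V), x ∈ V ∧ s.val V hV l = s'.val V hV l) :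
    s = s' := by
  ext V hV l
  refine E.sec_ext fun x hx => ?_
  obtain ⟨W, hW, m, hxW, e⟩ := h x (hV hx)
  refine ⟨W ⊓ V, inf_le_right, ⟨hxW, hx⟩, ?_⟩
  have e' := congrArg (E.res (inf_le_left : W ⊓ V ≤ W)) e
  rw [s.val_res, s'.val_res] at e'
  rw [s.val_res, s'.val_res, s.val_trans _ (t.res inf_le_left m), e', ← s'.val_trans]

/-- The presheaf of sections of the twist. -/
def famPresheaf : TopCat.Presheaf (Type u) X where
  obj U := t.Fam E U.unop
  map i := ↾fun s => ⟨fun V h l => s.val V (h.trans i.unop.le) l,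
    fun _ hW l => s.val_res _ hW l, fun _ l l' => s.val_trans _ l l'⟩
  map_id _ := rfl
  map_comp _ _ := rfl

theorem famPresheaf_isSheaf : (t.famPresheaf E).IsSheaf := by
  refine TopCat.Presheaf.isSheaf_of_isSheafUniqueGluing_types _ ?_
  intro ι U sf hsf
  have key : ∀ (i j : ι) (V : Opens X) (hi : V ≤ U i) (hj : V ≤ U j) (l : t.L V),
      (sf i).val V hi l = (sf j).val V hj l := fun i j V hi hj l =>
    congrArg (fun s : t.Fam E (U i ⊓ U j) => s.val V (le_inf hi hj) l) (hsf i j)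
  -- the value at `l ∈ L(V)` is glued from the values of the given sections on the `V ⊓ U i`
  have glue : ∀ (V : Opens X) (hV : V ≤ iSup U) (l : t.L V), ∃ s : E.Sec V, ∀ i,
      E.res (inf_le_left : V ⊓ U i ≤ V) s
        = (sf i).val (V ⊓ U i) inf_le_right (t.res inf_le_left l) := by
    intro V hV l
    refine E.sec_glue (fun i => V ⊓ U i) (fun _ => inf_le_left)
      (fun x hx => (Opens.mem_iSup.1 (hV hx)).imp fun i hi => ⟨hx, hi⟩) _ fun i j => ?_
    rw [(sf i).val_res, (sf j).val_res, t.res_res, t.res_res]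
    exact key i j _ _ _ _
  choose v hv using glue
  have hv' : ∀ (V : Opens X) (hV : V ≤ iSup U) (l : t.L V) (i : ι) (W : Opens X) (hW : W ≤ V)
      (hi : W ≤ U i), E.res hW (v V hV l) = (sf i).val W hi (t.res hW l) := by
    intro V hV l i W hW hi
    have := congrArg (E.res (le_inf hW hi)) (hv V hV l i)
    rwa [E.res_res, (sf i).val_res, t.res_res] at this
  refine ⟨⟨v, fun {V W} hV hW l => E.sec_ext fun x hx => ?_,
    fun {V} hV l l' => E.sec_ext fun x hx => ?_⟩, fun i => ?_, fun s hs => ?_⟩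
  · obtain ⟨i, hi⟩ := Opens.mem_iSup.1 (hV (hW hx))
    refine ⟨W ⊓ U i, inf_le_left, ⟨hx, hi⟩, ?_⟩
    rw [E.res_res, hv' V hV l i _ _ inf_le_right, hv' W _ _ i _ _ inf_le_right, t.res_res]
  · obtain ⟨i, hi⟩ := Opens.mem_iSup.1 (hV hx)
    refine ⟨V ⊓ U i, inf_le_left, ⟨hx, hi⟩, ?_⟩
    rw [E.res_act, hv' V hV l' i _ _ inf_le_right, hv' V hV l i _ _ inf_le_right, t.trans_res,
      ← (sf i).val_trans]
  · refine Fam.ext (funext fun V => funext fun hV => funext fun l => ?_)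
    have := hv' V (hV.trans (le_iSup U i)) l i V le_rfl hV
    rwa [E.res_self, t.res_self] at this
  · refine Fam.ext (funext fun V => funext fun hV => funext fun l => ?_)
    refine E.sec_ext fun x hx => ?_
    obtain ⟨i, hi⟩ := Opens.mem_iSup.1 (hV hx)
    refine ⟨V ⊓ U i, inf_le_left, ⟨hx, hi⟩, ?_⟩
    rw [hv' V hV l i _ _ inf_le_right, ← hs i]
    exact s.val_res hV inf_le_left l

/-- The section `ε ⊗ l` of the twist of `E`. -/
def pure {E : SheafTorsor 𝒢} {U : Opens X} (ε : E.Sec U) (l : t.L U) : t.Fam E U where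
  val V hV l' := E.act (E.res hV ε) (t.trans (t.res hV l) l')
  val_res hV hW l' := by rw [E.res_act, E.res_res, t.trans_res, t.res_res]
  val_trans hV l l' := by rw [← E.act_mul, t.trans_mul]

theorem pure_val {E : SheafTorsor 𝒢} {U : Opens X} (ε : E.Sec U) (l l' : t.L U) :
    (t.pure ε l).val U le_rfl l' = E.act ε (t.trans l l') := by
  simp only [pure, E.res_self, t.res_self]

theorem pure_val_self {E : SheafTorsor 𝒢} {U : Opens X} (s : t.Fam E U) (l : t.L U) :
    t.pure (s.val U le_rfl l) l = s := by
  ext V hV l'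
  simp only [pure]
  rw [s.val_res, ← s.val_trans]

theorem pure_act_trans {E : SheafTorsor 𝒢} {U : Opens X} (ε : E.Sec U) (l l' : t.L U) :
    t.pure (E.act ε (t.trans l l')) l' = t.pure ε l := by
  rw [← t.pure_val, t.pure_val_self]

theorem eq_of_pure_eq {E : SheafTorsor 𝒢} {U : Opens X} {ε ε' : E.Sec U} {l l' : t.L U}
    (h : t.pure ε l = t.pure ε' l') : ε' = E.act ε (t.trans l l') := by
  rw [← t.pure_val, h, t.pure_val, t.trans_self, E.act_one]

/-- The action of `𝒢'` on the twist, `(ε ⊗ l) · μ = (ε · conj_l⁻¹ μ) ⊗ l`. -/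
def famAct {E : SheafTorsor 𝒢} {U : Opens X} (s : t.Fam E U) (μ : GrpSec 𝒢' U) : t.Fam E U where
  val V hV l := E.act (s.val V hV l) ((t.conj l).symm (gres 𝒢' hV μ))
  val_res hV hW l := by rw [E.res_act, s.val_res, t.conj_symm_res, gres_gres]
  val_trans hV l l' := by
    rw [s.val_trans hV l l', ← E.act_mul, ← E.act_mul, t.conj_symm_trans]

theorem famAct_pure {E : SheafTorsor 𝒢} {U : Opens X} (ε : E.Sec U) (l : t.L U)
    (φ : GrpSec 𝒢 U) : t.famAct (t.pure ε l) (t.conj l φ) = t.pure (E.act ε φ) l := by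
  ext V hV l'
  simp only [pure, famAct]
  rw [t.conj_res, ← E.act_mul, t.conj_symm_trans, MulEquiv.symm_apply_apply, E.res_act,
    ← E.act_mul]

/-- The action of `𝒢'` on the twist is simply transitive: over `V` with `l ∈ L(V)` this is the
corresponding property of `E`, and the elements found over such `V` glue. -/
theorem famAct_simply_transitive {E : SheafTorsor 𝒢} {U : Opens X} (s s' : t.Fam E U) :
    ∃! μ, t.famAct s μ = s' := by
  -- `m` carries `s` to `s'`, as seen by `l`; by `P_change` this does not depend on `l`
  let P (V : Opens X) (hV : V ≤ U) (l : t.L V) (m : GrpSec 𝒢' V) : Prop :=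
    E.act (s.val V hV l) ((t.conj l).symm m) = s'.val V hV l
  have P_res : ∀ {V W : Opens X} (hV : V ≤ U) (hW : W ≤ V) (l : t.L V) (m : GrpSec 𝒢' V),
      P V hV l m → P W (hW.trans hV) (t.res hW l) (gres 𝒢' hW m) := by
    intro V W hV hW l m h
    simp only [P] at h ⊢
    rw [← s.val_res hV, ← s'.val_res hV, ← h, E.res_act, t.conj_symm_res]
  have P_change : ∀ {V : Opens X} (hV : V ≤ U) (l l' : t.L V) (m : GrpSec 𝒢' V),
      P V hV l m → P V hV l' m := by
    intro V hV l l' m h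
    simp only [P] at h ⊢
    rw [s.val_trans hV l l', s'.val_trans hV l l', ← h, ← E.act_mul, ← E.act_mul,
      t.conj_symm_trans]
  have P_unique : ∀ {V : Opens X} (hV : V ≤ U) (l : t.L V) (m m' : GrpSec 𝒢' V),
      P V hV l m → P V hV l m' → m = m' := fun hV l m m' h h' =>
    (t.conj l).symm.injective (E.act_cancel _ (Eq.trans h (Eq.symm h')))
  choose V hVU hxV l using fun x : U => t.exists_le x.2
  have ex : ∀ x : U, ∃ m, P (V x) (hVU x) (l x).some m := by
    intro x
    obtain ⟨g, hg, -⟩ := E.simply_transitive (s.val (V x) (hVU x) (l x).some)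
      (s'.val (V x) (hVU x) (l x).some)
    exact ⟨t.conj (l x).some g, by simpa only [P, MulEquiv.symm_apply_apply] using hg⟩
  choose m hm using ex
  obtain ⟨μ, hμ⟩ := grpSec_glue V hVU (fun x hx => ⟨⟨x, hx⟩, hxV _⟩) m fun i j =>
    P_unique (inf_le_left.trans (hVU i)) _ _ _ (P_res (hVU i) inf_le_left _ _ (hm i))
      (P_change _ _ _ _ (P_res (hVU j) inf_le_right _ _ (hm j)))
  refine ⟨μ, Fam.ext_local fun x hx => ⟨V ⟨x, hx⟩, hVU _, (l ⟨x, hx⟩).some, hxV _, ?_⟩, ?_⟩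
  · have := hm ⟨x, hx⟩
    rw [← hμ] at this
    exact this
  · intro μ' hμ'
    refine grpSec_ext fun x hx => ⟨V ⟨x, hx⟩, hVU _, hxV _, ?_⟩
    rw [hμ]
    refine P_unique (hVU _) (l ⟨x, hx⟩).some _ _ ?_ (hm _)
    exact congrArg (fun q : t.Fam E U => q.val _ (hVU _) (l ⟨x, hx⟩).some) hμ'

/-- The twist of a `𝒢`-torsor, a `𝒢'`-torsor. -/
def torsor : SheafTorsor 𝒢' where
  sheaf := ⟨t.famPresheaf E, t.famPresheaf_isSheaf E⟩
  act s μ := t.famAct s μ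
  act_one s := by
    refine Fam.ext (funext fun V => funext fun hV => funext fun l => ?_)
    simp only [famAct, map_one, E.act_one]
  act_mul s g h := by
    refine Fam.ext (funext fun V => funext fun hV => funext fun l => ?_)
    simp only [famAct, map_mul, E.act_mul]
  act_res i s g := by
    refine Fam.ext (funext fun V => funext fun hV => funext fun l => ?_)
    exact congrArg (fun q => E.act _ ((t.conj l).symm q)) (gres_gres i.le hV g).symm
  locally_nonempty x := by
    obtain ⟨V, hV, ⟨l⟩⟩ := t.exists_mem x
    obtain ⟨W, hW, ⟨s⟩⟩ := E.locally_nonempty x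
    exact ⟨V ⊓ W, ⟨hV, hW⟩, ⟨t.pure (E.res inf_le_right s) (t.res inf_le_left l)⟩⟩
  simply_transitive s s' := t.famAct_simply_transitive s s'

/-- The action of a morphism of torsors on sections of the twists. -/
def famMap {E F : SheafTorsor 𝒢} (f : E ⟶ F) {U : Opens X} (s : t.Fam E U) : t.Fam F U where
  val V hV l := Hom.onSec f (s.val V hV l)
  val_res hV hW l := by rw [← Hom.onSec_res, s.val_res]
  val_trans hV l l' := by rw [← Hom.onSec_act, ← s.val_trans]

theorem famMap_pure {E F : SheafTorsor 𝒢} (f : E ⟶ F) {U : Opens X} (ε : E.Sec U) (l : t.L U) :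
    t.famMap f (t.pure ε l) = t.pure (Hom.onSec f ε) l := by
  ext V hV l'
  simp only [pure, famMap]
  rw [Hom.onSec_act, Hom.onSec_res]

/-- Twisting, as a functor between categories of torsors. -/
def functor : SheafTorsor 𝒢 ⥤ SheafTorsor 𝒢' where
  obj E := t.torsor E
  map {E F} f :=
    { map := ⟨{ app := fun _ => ↾fun s => t.famMap f s
                naturality := fun _ _ _ => rfl }⟩
      equivariant := fun s μ => by
        refine Fam.ext (funext fun V => funext fun hV => funext fun l => ?_)
        exact Hom.onSec_act f _ _ }
  map_id _ := rfl
  map_comp _ _ := rfl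

/-- The section `l ↦ (l' ↦ ε · trans l l')` of the twist of the twist, that is `(ε ⊗ l) ⊗ l`, where
the second factor refers to the inverse identifications. -/
def unitFam {E : SheafTorsor 𝒢} {U : Opens X} (ε : E.Sec U) :
    t.symm.Fam (t.torsor E) U where
  val V hV l := t.pure (E.res hV ε) l
  val_res {V W} hV hW (l : t.L V) := by
    refine Fam.ext (funext fun V' => funext fun hV' => funext fun l' => ?_)
    change E.act (E.res (hV'.trans hW) (E.res hV ε)) (t.trans (t.res (hV'.trans hW) l) l')
      = E.act (E.res hV' (E.res (hW.trans hV) ε)) (t.trans (t.res hV' (t.res hW l)) l')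
    rw [E.res_res, E.res_res, t.res_res]
  val_trans {V} hV (l l' : t.L V) := by
    change t.pure (E.res hV ε) l' = t.famAct (t.pure _ l) (t.conj l (t.trans l' l))
    rw [t.famAct_pure]
    ext W hW m
    simp only [pure]
    rw [E.res_act, t.trans_res, ← E.act_mul, t.trans_mul]

/-- The natural map from a torsor to its twist by `t` and then by `t.symm`. -/
def unitHom : 𝟭 (SheafTorsor 𝒢) ⟶ t.functor ⋙ t.symm.functor where
  app E :=
    { map := ⟨{ app := fun _ => ↾fun ε => t.unitFam (E := E) ε
                naturality := fun U V i => by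
                  ext ε
                  refine Fam.ext (funext fun W => funext fun hW => funext fun l => ?_)
                  exact congrArg (fun q => t.pure q l) (E.res_res i.unop.le hW ε) }⟩
      equivariant := fun {U} ε φ => by
        refine Fam.ext (funext fun V => funext fun hV => funext fun (l : t.L V) => ?_)
        change t.pure (E.res hV (E.act ε φ)) l
          = t.famAct (t.pure (E.res hV ε) l) (t.conj l (gres 𝒢 hV φ))
        rw [t.famAct_pure, E.res_act] }
  naturality E F f := by
    refine Hom.ext ?_
    refine Sheaf.hom_ext ?_
    ext U ε
    refine Fam.ext (funext fun W => funext fun hW => funext fun (l : t.L W) => ?_)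
    change t.pure (F.res hW (Hom.onSec f ε)) l = t.famMap f (t.pure (E.res hW ε) l)
    rw [t.famMap_pure, Hom.onSec_res]

theorem symm_symm (t : Twist 𝒢 𝒢') : t.symm.symm = t := by
  have h : ∀ {U : Opens X} (l l' : t.L U),
      (t.conj l).symm (t.conj l' (t.trans l l')) = t.trans l l' := fun l l' => by
    rw [t.conj_symm_conj, mul_assoc, t.trans_mul, t.trans_self, mul_one]
  obtain ⟨L, res, _, _, conj, trans, _, _, _, _, _⟩ := t
  simp only at h
  simp only [symm, MulEquiv.symm_symm, h]

/-- Twisting is an equivalence of categories, with inverse the twist by `t.symm`. -/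
theorem functor_isEquivalence : t.functor.IsEquivalence := by
  have h : ∀ {𝒢 𝒢' : X.Sheaf GrpCat.{u}} (t : Twist 𝒢 𝒢'), IsIso t.unitHom := fun t => by
    have : ∀ E, IsIso (t.unitHom.app E) := fun E => Hom.isIso _
    exact NatIso.isIso_of_isIso_app _
  have := h t
  have h' := h t.symm
  have e : t.symm.functor ⋙ t.functor ≅ 𝟭 _ :=
    Functor.isoWhiskerLeft _ (eqToIso (congrArg functor t.symm_symm).symm) ≪≫
      (asIso t.symm.unitHom).symm
  have := h t
  exact (CategoryTheory.Equivalence.mk t.functor t.symm.functor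
    (asIso t.unitHom) e).isEquivalence_functor

end Twist

end Twist

end SheafTorsor

namespace Parahoric

/-! ### One-parameter subgroups of complex Lie groups -/

section OneParam

variable {E : Type*} [NormedAddCommGroup E] [NormedSpace ℂ E]
  {G : Type u} [Group G] [TopologicalSpace G] [ChartedSpace E G]

/-- The velocity at `0` of a holomorphic curve through the identity, read in the chart at `1`. -/
theorem hasDerivAt_chart {f : ℂ → G} (h0 : f 0 = 1) (hf : ContMDiff 𝓘(ℂ, ℂ) 𝓘(ℂ, E) ω f) :
    HasDerivAt (fun z => chartAt E (1 : G) (f z)) (mfderiv 𝓘(ℂ, ℂ) 𝓘(ℂ, E) f 0 (1 : ℂ) : E) 0 := by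
  have h := ((hf 0).mdifferentiableAt (by simp)).hasMFDerivAt.2
  simp only [writtenInExtChartAt, mfld_simps] at h
  let L : ℂ →L[ℂ] E := mfderiv 𝓘(ℂ, ℂ) 𝓘(ℂ, E) f 0
  have h2 : HasFDerivAt (fun z => chartAt E (f 0) (f z)) L 0 := hasFDerivWithinAt_univ.1 h
  rw [← h0]
  exact h2.hasDerivAt

theorem IsOneParam.hasDerivAt {v : GroupLieAlgebra 𝓘(ℂ, E) G} {γ : ℂ → G} (h : IsOneParam v γ) :
    HasDerivAt (fun z => chartAt E (1 : G) (γ z)) (v : E) 0 := by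
  have := hasDerivAt_chart h.zero h.holo
  rwa [h.deriv] at this

/-- A holomorphic homomorphism from `ℂ` is the one-parameter subgroup of its velocity in the chart
at `1`. -/
theorem IsOneParam.of_hasDerivAt {v : E} {γ : ℂ → G} (zero : γ 0 = 1)
    (add : ∀ s t, γ (s + t) = γ s * γ t) (holo : ContMDiff 𝓘(ℂ, ℂ) 𝓘(ℂ, E) ω γ)
    (h : HasDerivAt (fun z => chartAt E (1 : G) (γ z)) v 0) :
    IsOneParam (v : GroupLieAlgebra 𝓘(ℂ, E) G) γ :=
  ⟨zero, add, holo, (hasDerivAt_chart zero holo).unique h⟩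

theorem IsOneParam.nsmul {v : GroupLieAlgebra 𝓘(ℂ, E) G} {γ : ℂ → G} (h : IsOneParam v γ)
    (n : ℕ) (z : ℂ) : γ (n * z) = γ z ^ n := by
  induction n with
  | zero => simp [h.zero]
  | succ n ih => rw [pow_succ, ← ih, ← h.add]; congr 1; push_cast; ring

theorem IsOneParam.smul {v : GroupLieAlgebra 𝓘(ℂ, E) G} {γ : ℂ → G} (h : IsOneParam v γ) (c : ℂ) :
    IsOneParam (c • v) (fun z => γ (c * z)) := by
  refine IsOneParam.of_hasDerivAt (by simp [h.zero]) (fun s t => by rw [mul_add, h.add])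
    (h.holo.comp ((contDiff_const.mul contDiff_id).contMDiff)) ?_
  have h1 : HasDerivAt (fun z : ℂ => c * z) c 0 := by
    simpa using (hasDerivAt_id (0 : ℂ)).const_mul c
  have h2 := h.hasDerivAt
  rw [show (0 : ℂ) = c * 0 by simp] at h2
  exact h2.scomp (0 : ℂ) h1

theorem isOneParam_one : IsOneParam (0 : GroupLieAlgebra 𝓘(ℂ, E) G) (fun _ => (1 : G)) :=
  IsOneParam.of_hasDerivAt (v := (0 : E)) rfl (fun _ _ => (mul_one _).symm) contMDiff_const
    (hasDerivAt_const _ _)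

variable [LieGroup 𝓘(ℂ, E) ω G]

/-- Multiplication of `G` in the chart at `1`. -/
def chartMul (E : Type*) [NormedAddCommGroup E] [NormedSpace ℂ E] (G : Type u) [Group G]
    [TopologicalSpace G] [ChartedSpace E G] (p : E × E) : E :=
  chartAt E (1 : G) ((chartAt E (1 : G)).symm p.1 * (chartAt E (1 : G)).symm p.2)

theorem contDiffAt_chartMul :
    ContDiffAt ℂ ω (chartMul E G) (chartAt E (1 : G) 1, chartAt E (1 : G) 1) := by
  rw [← contMDiffAt_iff_contDiffAt]
  have hs : ContMDiffAt 𝓘(ℂ, E) 𝓘(ℂ, E) ω (chartAt E (1 : G)).symm (chartAt E (1 : G) 1) :=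
    (contMDiffOn_chart_symm (I := 𝓘(ℂ, E)) (n := ω) (x := (1 : G))).contMDiffAt
      (chart_target_mem_nhds _ _)
  have h1 : ContMDiffAt 𝓘(ℂ, E × E) 𝓘(ℂ, E) ω
      (fun p : E × E => (chartAt E (1 : G)).symm p.1)
      (chartAt E (1 : G) 1, chartAt E (1 : G) 1) :=
    ContMDiffAt.comp (I' := 𝓘(ℂ, E)) (f := Prod.fst)
      (chartAt E (1 : G) 1, chartAt E (1 : G) 1) hs contDiff_fst.contMDiff.contMDiffAt
  have h2 : ContMDiffAt 𝓘(ℂ, E × E) 𝓘(ℂ, E) ω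
      (fun p : E × E => (chartAt E (1 : G)).symm p.2)
      (chartAt E (1 : G) 1, chartAt E (1 : G) 1) :=
    ContMDiffAt.comp (I' := 𝓘(ℂ, E)) (f := Prod.snd)
      (chartAt E (1 : G) 1, chartAt E (1 : G) 1) hs contDiff_snd.contMDiff.contMDiffAt
  have hc : ContMDiffAt 𝓘(ℂ, E) 𝓘(ℂ, E) ω (chartAt E (1 : G)) (1 : G) :=
    (contMDiffOn_chart (I := 𝓘(ℂ, E)) (n := ω) (x := (1 : G))).contMDiffAt
      (chart_source_mem_nhds _ _)
  refine ContMDiffAt.comp (I' := 𝓘(ℂ, E))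
    (f := fun p : E × E => (chartAt E (1 : G)).symm p.1 * (chartAt E (1 : G)).symm p.2)
    _ ?_ (h1.mul h2)
  simpa using hc

/-- Near `0`, a one-parameter subgroup solves, in the chart at `1`, the differential equation of
the left-invariant vector field `x ↦ ∂₂m(x, 1) v`. -/
theorem IsOneParam.eventually_hasDerivAt {v : GroupLieAlgebra 𝓘(ℂ, E) G} {γ : ℂ → G}
    (h : IsOneParam v γ) : ∀ᶠ z in 𝓝 (0 : ℂ), HasDerivAt (fun z => chartAt E (1 : G) (γ z))
      (fderiv ℂ (chartMul E G) (chartAt E (1 : G) (γ z), chartAt E (1 : G) 1)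
        ((0 : E), (v : E))) z := by
  have hu := h.hasDerivAt
  have cu : Filter.Tendsto (fun z => (chartAt E (1 : G) (γ z), chartAt E (1 : G) 1)) (𝓝 0)
      (𝓝 (chartAt E (1 : G) 1, chartAt E (1 : G) 1)) := by
    have := hu.continuousAt.tendsto
    simp only [h.zero] at this
    exact this.prodMk_nhds tendsto_const_nhds
  have hd : ∀ᶠ z in 𝓝 (0 : ℂ), ContDiffAt ℂ ω (chartMul E G)
      (chartAt E (1 : G) (γ z), chartAt E (1 : G) 1) :=
    cu.eventually ((contDiffAt_chartMul (E := E) (G := G)).eventually (by simp))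
  have hs : ∀ᶠ z in 𝓝 (0 : ℂ), γ z ∈ (chartAt E (1 : G)).source := by
    have : ContinuousAt γ 0 := h.holo.continuous.continuousAt
    refine this.eventually_mem ?_
    rw [h.zero]
    exact chart_source_mem_nhds _ _
  filter_upwards [hd, hs] with z hz hzs
  have h1 : HasDerivAt (fun s => (chartAt E (1 : G) (γ z), chartAt E (1 : G) (γ s)))
      ((0 : E), (v : E)) 0 := (hasDerivAt_const _ _).prodMk hu
  have h2 : HasFDerivAt (chartMul E G)
      (fderiv ℂ (chartMul E G) (chartAt E (1 : G) (γ z), chartAt E (1 : G) 1))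
      (chartAt E (1 : G) (γ z), chartAt E (1 : G) (γ 0)) := by
    rw [h.zero]
    exact (hz.differentiableAt (by simp)).hasFDerivAt
  have h3 := h2.comp_hasDerivAt (0 : ℂ) h1
  have h4 : HasDerivAt (fun s => chartAt E (1 : G) (γ (z + s)))
      (fderiv ℂ (chartMul E G) (chartAt E (1 : G) (γ z), chartAt E (1 : G) 1)
        ((0 : E), (v : E))) 0 := by
    refine h3.congr_of_eventuallyEq ?_
    filter_upwards [hs] with s hss
    simp only [Function.comp, chartMul]
    rw [OpenPartialHomeomorph.left_inv _ hzs, OpenPartialHomeomorph.left_inv _ hss, h.add]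
  have h5 := HasDerivAt.comp_sub_const z z (f := fun s => chartAt E (1 : G) (γ (z + s)))
    (by rwa [sub_self])
  simpa using h5

/-- A one-parameter subgroup is determined by its velocity: uniqueness of solutions of ordinary
differential equations gives equality near `0`, and powers propagate it to `ℂ`. -/
theorem IsOneParam.unique {v : GroupLieAlgebra 𝓘(ℂ, E) G} {γ δ : ℂ → G} (h : IsOneParam v γ)
    (h' : IsOneParam v δ) : γ = δ := by
  let F : E → E := fun x =>
    fderiv ℂ (chartMul E G) (x, chartAt E (1 : G) 1) ((0 : E), (v : E))
  have hF : ContDiffAt ℂ 1 F (chartAt E (1 : G) 1) := by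
    have h1 : ContDiffAt ℂ 1 (fderiv ℂ (chartMul E G))
        (chartAt E (1 : G) 1, chartAt E (1 : G) 1) :=
      (contDiffAt_chartMul (E := E) (G := G)).fderiv_right (by simp)
    have h2 : ContDiffAt ℂ 1 (fun x : E => (x, chartAt E (1 : G) 1)) (chartAt E (1 : G) 1) :=
      contDiffAt_id.prodMk contDiffAt_const
    exact (ContDiffAt.comp (f := fun x : E => (x, chartAt E (1 : G) 1))
      (chartAt E (1 : G) 1) h1 h2).clm_apply contDiffAt_const
  obtain ⟨K, S, hS, hK⟩ := hF.exists_lipschitzOnWith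
  have hcont : ∀ {γ : ℂ → G}, IsOneParam v γ → ∀ z : ℂ,
      Filter.Tendsto (fun t : ℝ => γ (t * z)) (𝓝 0) (𝓝 1) := fun {γ} h z => by
    have : Continuous (fun t : ℝ => γ (t * z)) := h.holo.continuous.comp (by fun_prop)
    have h0 := this.tendsto 0
    simp only [Complex.ofReal_zero, zero_mul, h.zero] at h0
    exact h0
  have hline : ∀ {γ : ℂ → G}, IsOneParam v γ → ∀ z : ℂ, ∀ᶠ t : ℝ in 𝓝 0,
      HasDerivAt (fun t : ℝ => chartAt E (1 : G) (γ (t * z)))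
        (z • F (chartAt E (1 : G) (γ (t * z)))) t ∧ chartAt E (1 : G) (γ (t * z)) ∈ S := by
    intro γ h z
    have c1 : Filter.Tendsto (fun t : ℝ => (t : ℂ) * z) (𝓝 0) (𝓝 0) := by
      have : Continuous (fun t : ℝ => (t : ℂ) * z) := by fun_prop
      simpa using this.tendsto 0
    have c2 : Filter.Tendsto (fun t : ℝ => chartAt E (1 : G) (γ (t * z))) (𝓝 0)
        (𝓝 (chartAt E (1 : G) 1)) :=
      ((chartAt E (1 : G)).continuousAt (mem_chart_source E (1 : G))).tendsto.comp (hcont h z)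
    filter_upwards [c1.eventually h.eventually_hasDerivAt, c2.eventually_mem hS] with t ht hts
    refine ⟨?_, hts⟩
    have e : HasDerivAt (fun w : ℝ => (w : ℂ) * z) z t := by
      simpa using (hasDerivAt_id t).ofReal_comp.mul_const z
    exact ht.scomp t e
  -- for fixed `z`, both `t ↦ γ (t z)` and `t ↦ δ (t z)` solve `u' = z F(u)` near `t = 0`
  have key : ∀ z : ℂ, ∀ᶠ t : ℝ in 𝓝 0, γ (t * z) = δ (t * z) := by
    intro z
    have e := ODE_solution_unique_of_eventually (v := fun _ x => z • F x) (s := fun _ => S)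
      (K := ‖z‖₊ * K) (t₀ := (0 : ℝ)) (f := fun t : ℝ => chartAt E (1 : G) (γ (t * z)))
      (g := fun t : ℝ => chartAt E (1 : G) (δ (t * z)))
      (Filter.Eventually.of_forall fun _ => by
        have := (lipschitzWith_smul z (β := E)).comp_lipschitzOnWith hK
        exact this) (hline h z) (hline h' z)
      (by simp [h.zero, h'.zero])
    filter_upwards [e, (hcont h z).eventually_mem (chart_source_mem_nhds E (1 : G)),
      (hcont h' z).eventually_mem (chart_source_mem_nhds E (1 : G))] with t e1 e2 e3
    exact (chartAt E (1 : G)).injOn e2 e3 e1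
  funext z
  have : Filter.Tendsto (fun n : ℕ => ((n : ℝ) + 1)⁻¹) Filter.atTop (𝓝 0) := by
    simpa using tendsto_one_div_add_atTop_nhds_zero_nat (𝕜 := ℝ)
  obtain ⟨n, hn⟩ := (this.eventually (key z)).exists
  have hz : z = ((n + 1 : ℕ) : ℂ) * ((((n : ℝ) + 1)⁻¹ : ℝ) * z) := by
    push_cast
    field_simp
  rw [hz, h.nsmul, h'.nsmul, hn]

theorem IsOneParam.lieExp_eq {v : GroupLieAlgebra 𝓘(ℂ, E) G} {γ : ℂ → G} (h : IsOneParam v γ) :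
    lieExp v = γ 1 := by
  have ex : ∃ γ : ℂ → G, IsOneParam v γ := ⟨γ, h⟩
  rw [lieExp, dif_pos ex, (Classical.choose_spec ex).unique h]

theorem IsOneParam.lieExp_smul {v : GroupLieAlgebra 𝓘(ℂ, E) G} {γ : ℂ → G} (h : IsOneParam v γ)
    (c : ℂ) : lieExp (c • v) = γ c := by
  rw [(h.smul c).lieExp_eq, mul_one]

/-- Two one-parameter subgroups which agree on the real line are equal. -/
theorem IsOneParam.eq_of_real {v w : GroupLieAlgebra 𝓘(ℂ, E) G} {γ δ : ℂ → G}
    (h : IsOneParam v γ) (h' : IsOneParam w δ) (e : ∀ t : ℝ, γ t = δ t) : v = w ∧ γ = δ := by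
  have hr : ∀ {v : E} {γ : ℂ → G}, HasDerivAt (fun z => chartAt E (1 : G) (γ z)) v 0 →
      HasDerivAt (fun t : ℝ => chartAt E (1 : G) (γ t)) v 0 := fun {v γ} h => by
    have e : HasDerivAt (fun w : ℝ => (w : ℂ)) 1 0 := by
      simpa using (hasDerivAt_id (0 : ℝ)).ofReal_comp
    rw [← Complex.ofReal_zero] at h
    have := h.scomp (0 : ℝ) e
    rwa [one_smul] at this
  have h1 := hr h.hasDerivAt
  have h2 := hr h'.hasDerivAt
  simp only [e] at h1
  have : v = w := h1.unique h2
  subst this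
  exact ⟨rfl, h.unique h'⟩

theorem IsOneParam.exists_conj {v : GroupLieAlgebra 𝓘(ℂ, E) G} {γ : ℂ → G} (h : IsOneParam v γ)
    (g : G) : ∃ w : GroupLieAlgebra 𝓘(ℂ, E) G, IsOneParam w (fun z => g * γ z * g⁻¹) :=
  ⟨_, by simp [h.zero], fun s t => by rw [h.add]; group,
    (contMDiff_const.mul h.holo).mul contMDiff_const, rfl⟩

/-- An element which commutes with the real points of a one-parameter subgroup commutes with all
of it. -/
theorem IsOneParam.commute_of_real {v : GroupLieAlgebra 𝓘(ℂ, E) G} {γ : ℂ → G}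
    (h : IsOneParam v γ) {g : G} (e : ∀ t : ℝ, Commute g (γ t)) (z : ℂ) : Commute g (γ z) := by
  obtain ⟨w, hw⟩ := h.exists_conj g
  have := (hw.eq_of_real h fun t => by rw [(e t).eq]; group).2
  exact mul_inv_eq_iff_eq_mul.1 (congrFun this z)

theorem IsOneParam.commute {v w : GroupLieAlgebra 𝓘(ℂ, E) G} {γ δ : ℂ → G}
    (h : IsOneParam v γ) (h' : IsOneParam w δ) (e : ∀ s t : ℝ, Commute (γ s) (δ t)) (y z : ℂ) :
    Commute (γ y) (δ z) :=
  h'.commute_of_real (fun t => (h.commute_of_real (fun s => (e s t).symm) y).symm) z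

/-- The product of commuting one-parameter subgroups. -/
theorem IsOneParam.mul {v w : GroupLieAlgebra 𝓘(ℂ, E) G} {γ δ : ℂ → G}
    (h : IsOneParam v γ) (h' : IsOneParam w δ) (e : ∀ y z : ℂ, Commute (γ y) (δ z)) :
    IsOneParam (v + w) (fun z => γ z * δ z) := by
  have hm := (contDiffAt_chartMul (E := E) (G := G)).differentiableAt (by simp)
  refine IsOneParam.of_hasDerivAt (v := (show E from v) + (show E from w))
    (by simp [h.zero, h'.zero]) (fun s t => ?_) (h.holo.mul h'.holo) ?_
  · rw [h.add, h'.add, mul_assoc, ← mul_assoc (γ t), (e t s).eq]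
    group
  have hs : ∀ {v : GroupLieAlgebra 𝓘(ℂ, E) G} {γ : ℂ → G}, IsOneParam v γ →
      ∀ᶠ z in 𝓝 (0 : ℂ), γ z ∈ (chartAt E (1 : G)).source := fun {v γ} h => by
    have : ContinuousAt γ 0 := h.holo.continuous.continuousAt
    refine this.eventually_mem ?_
    rw [h.zero]
    exact chart_source_mem_nhds _ _
  -- applied to `(γ, 1)`, `(1, δ)` and `(γ, δ)`, this gives the differential of the multiplication
  -- at `(1, 1)` on `(v, 0)`, `(0, w)` and `(v, w)`
  have D : ∀ {a b : E} {γ δ : ℂ → G}, γ 0 = 1 → δ 0 = 1 →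
      HasDerivAt (fun z => chartAt E (1 : G) (γ z)) a 0 →
      HasDerivAt (fun z => chartAt E (1 : G) (δ z)) b 0 →
      (∀ᶠ z in 𝓝 (0 : ℂ), γ z ∈ (chartAt E (1 : G)).source) →
      (∀ᶠ z in 𝓝 (0 : ℂ), δ z ∈ (chartAt E (1 : G)).source) →
      HasDerivAt (fun z => chartAt E (1 : G) (γ z * δ z))
        (fderiv ℂ (chartMul E G) (chartAt E (1 : G) 1, chartAt E (1 : G) 1) (a, b)) 0 := by
    intro a b γ δ h0 h0' ha hb hsγ hsδ
    have h2 : HasFDerivAt (chartMul E G)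
        (fderiv ℂ (chartMul E G) (chartAt E (1 : G) 1, chartAt E (1 : G) 1))
        (chartAt E (1 : G) (γ 0), chartAt E (1 : G) (δ 0)) := by
      rw [h0, h0']
      exact hm.hasFDerivAt
    refine (h2.comp_hasDerivAt (0 : ℂ) (ha.prodMk hb)).congr_of_eventuallyEq ?_
    filter_upwards [hsγ, hsδ] with s h1 h2
    simp only [Function.comp, chartMul]
    rw [OpenPartialHomeomorph.left_inv _ h1, OpenPartialHomeomorph.left_inv _ h2]
  have one : HasDerivAt (fun _ : ℂ => chartAt E (1 : G) (1 : G)) (0 : E) 0 := hasDerivAt_const _ _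
  have one_s : ∀ᶠ _ in 𝓝 (0 : ℂ), (1 : G) ∈ (chartAt E (1 : G)).source :=
    Filter.Eventually.of_forall fun _ => mem_chart_source _ _
  have d1 := D (δ := fun _ => 1) h.zero rfl h.hasDerivAt one (hs h) one_s
  have d2 := D (γ := fun _ => 1) rfl h'.zero one h'.hasDerivAt one_s (hs h')
  simp only [mul_one, one_mul] at d1 d2
  have d := D h.zero h'.zero h.hasDerivAt h'.hasDerivAt (hs h) (hs h')
  have hL : ∀ (L : E × E →L[ℂ] E) (a b : E), L (a, 0) = a → L (0, b) = b → L (a, b) = a + b := by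
    intro L a b ha hb
    have := map_add L (a, 0) (0, b)
    rwa [ha, hb, Prod.mk_add_mk, add_zero, zero_add] at this
  rwa [hL _ _ _ (d1.unique h.hasDerivAt) (d2.unique h'.hasDerivAt)] at d

end OneParam

end Parahoric

/-! ### Continuous homomorphisms from the line to the circle -/

section CircleHom

/-- A continuous homomorphism `ℝ → S¹` with period `1` is `t ↦ e^{2π√-1 n t}` for an integer `n`.
Averaging over an interval shows that it is differentiable, hence an exponential. -/
theorem Circle.exists_eq_exp_of_continuous_hom {f : ℝ → Circle} (hc : Continuous f)
    (hadd : ∀ s t, f (s + t) = f s * f t) (h1 : f 1 = 1) :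
    ∃ n : ℤ, ∀ t, f t = Circle.exp (2 * Real.pi * n * t) := by
  let g : ℝ → ℂ := fun t => f t
  have hg : Continuous g := (by fun_prop : Continuous ((↑) : Circle → ℂ)).comp hc
  have gadd : ∀ s t, g (s + t) = g s * g t := fun s t => by simp [g, hadd]
  have f0 : f 0 = 1 := by simpa using hadd 0 0
  have g0 : g 0 = 1 := by simp [g, f0]
  have hder : ∀ x, HasDerivAt (fun u => ∫ t in (0 : ℝ)..u, g t) (g x) x := fun x =>
    hg.integral_hasStrictDerivAt 0 x |>.hasDerivAt
  obtain ⟨c, hI⟩ : ∃ c : ℝ, ∫ t in (0 : ℝ)..c, g t ≠ 0 := by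
    by_contra! h
    have := (hder 0).unique (by simpa only [h] using hasDerivAt_const (0 : ℝ) (0 : ℂ))
    rw [g0] at this
    exact one_ne_zero this
  set J := ∫ t in (0 : ℝ)..c, g t with hJ
  -- `J · g x` is the integral of `g` over the translated interval
  have hint : ∀ x, g x = ((∫ t in (0 : ℝ)..(x + c), g t) - ∫ t in (0 : ℝ)..x, g t) / J := by
    intro x
    rw [eq_div_iff hI, intervalIntegral.integral_interval_sub_left
      (hg.intervalIntegrable _ _) (hg.intervalIntegrable _ _), hJ,
      ← intervalIntegral.integral_const_mul]
    simp only [← gadd]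
    rw [intervalIntegral.integral_comp_add_left]
    simp
  have hd : ∀ x, HasDerivAt g ((g c - 1) / J * g x) x := by
    intro x
    have h := ((((hder (x + c)).comp_add_const x c).sub (hder x)).div_const J)
    have e : (g c - 1) / J * g x = (g (x + c) - g x) / J := by rw [gadd]; ring
    rw [e]
    exact h.congr_of_eventuallyEq (Filter.Eventually.of_forall hint)
  set a := (g c - 1) / J
  have hexp : ∀ x : ℝ, HasDerivAt (fun x : ℝ => Complex.exp (-(a * x)))
      (Complex.exp (-(a * x)) * (-(a * 1))) x := fun x => by
    have : HasDerivAt (fun x : ℝ => -(a * (x : ℂ))) (-(a * 1)) x := by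
      have h := (((hasDerivAt_id x).ofReal_comp).const_mul a).neg
      rwa [Complex.ofReal_one] at h
    exact this.cexp
  have hconst : ∀ x, g x * Complex.exp (-(a * x)) = 1 := by
    intro x
    have hd0 : ∀ y, HasDerivAt (fun y : ℝ => g y * Complex.exp (-(a * y))) 0 y := fun y => by
      convert! (hd y).mul (hexp y) using 1
      ring
    have := is_const_of_deriv_eq_zero (fun y => (hd0 y).differentiableAt)
      (fun y => (hd0 y).deriv) x 0
    rw [this, g0]
    simp
  have hge : ∀ x, g x = Complex.exp (a * x) := fun x => by
    have := hconst x
    rw [Complex.exp_neg] at this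
    exact (mul_inv_eq_one₀ (Complex.exp_ne_zero _)).1 this
  have ha : Complex.exp a = 1 := by
    have := hge 1
    simp only [g, h1, Complex.ofReal_one, mul_one, Circle.coe_one] at this
    exact this.symm
  obtain ⟨n, hn⟩ := Complex.exp_eq_one_iff.1 ha
  refine ⟨n, fun t => Circle.ext ?_⟩
  rw [Circle.coe_exp]
  refine (hge t).trans ?_
  rw [hn]
  congr 1
  push_cast
  ring

end CircleHom

namespace Parahoric

/-! ### The complexified torus and its exponents -/

section Torus

theorem contMDiff_units {F M : Type*} [NormedAddCommGroup F] [NormedSpace ℂ F]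
    [TopologicalSpace M] [ChartedSpace F M] {f : M → ℂˣ}
    (h : ContMDiff 𝓘(ℂ, F) 𝓘(ℂ, ℂ) ω (fun x => (f x : ℂ))) : ContMDiff 𝓘(ℂ, F) 𝓘(ℂ, ℂ) ω f :=
  ContMDiff.of_comp_isOpenEmbedding Units.isOpenEmbedding_val h

/-- The exponential function, with values in the group `ℂˣ`. -/
def expUnit (w : ℂ) : ℂˣ := Units.mk0 (Complex.exp w) (Complex.exp_ne_zero w)

theorem expUnit_zero : expUnit 0 = 1 := Units.ext (by simp [expUnit])

theorem expUnit_add (s t : ℂ) : expUnit (s + t) = expUnit s * expUnit t :=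
  Units.ext (by simp [expUnit, Complex.exp_add])

theorem expUnit_log (u : ℂˣ) : expUnit (Complex.log u) = u :=
  Units.ext (Complex.exp_log u.ne_zero)

theorem toUnits_exp (x : ℝ) : Circle.toUnits (Circle.exp x) = expUnit (x * Complex.I) :=
  Units.ext (by simp [expUnit])

theorem contMDiff_expUnit : ContMDiff 𝓘(ℂ, ℂ) 𝓘(ℂ, ℂ) ω expUnit :=
  contMDiff_units Complex.contDiff_exp.contMDiff

variable {E : Type*} [NormedAddCommGroup E] [NormedSpace ℂ E]
  {G : Type u} [Group G] [TopologicalSpace G] [ChartedSpace E G]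
  {T : Subgroup G} {k : ℕ} (Θ : TorusCoords E T k)

/-- A property of maps to `G` which is stable under products holds for `Θ ∘ f` if it holds for the
components of `Θ ∘ f`. -/
theorem TorusCoords.induction_components {A : Type*} (P : (A → G) → Prop) (one : P fun _ => 1)
    (mul : ∀ f g, P f → P g → P fun x => f x * g x) (f : A → Fin k → ℂˣ)
    (h : ∀ i, P fun x => Θ.Θ (Pi.mulSingle i (f x i))) : P fun x => Θ.Θ (f x) := by
  classical
  have key : ∀ s : Finset (Fin k), P fun x => Θ.Θ (fun i => if i ∈ s then f x i else 1) := by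
    intro s
    induction s using Finset.induction_on with
    | empty =>
      convert! one using 2
      exact map_one Θ.Θ
    | insert i s hi ih =>
      convert! mul _ _ (h i) ih using 2 with x
      rw [← map_mul]
      congr 1
      funext j
      rcases eq_or_ne j i with rfl | hj
      · simp [hi]
      · simp [hj]
  simpa using key Finset.univ

theorem TorusCoords.commute (u v : Fin k → ℂˣ) : Commute (Θ.Θ u) (Θ.Θ v) :=
  (Commute.all u v).map Θ.Θ

theorem TorusCoords.isOneParam_chi (i : Fin k) :
    IsOneParam (Θ.chi i)
      (fun w => Θ.Θ (Pi.mulSingle i (expUnit (2 * Real.pi * Complex.I * w)))) where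
  zero := by simp [expUnit_zero]
  add s t := by rw [mul_add, expUnit_add, Pi.mulSingle_mul, map_mul]
  holo := (Θ.holo i).comp (contMDiff_expUnit.comp (contDiff_const.mul contDiff_id).contMDiff)
  deriv := rfl

theorem TorusCoords.isOneParam_mulSingle (i : Fin k) (c : ℂ) :
    IsOneParam ((c / (2 * Real.pi * Complex.I)) • Θ.chi i)
      (fun w => Θ.Θ (Pi.mulSingle i (expUnit (c * w)))) := by
  convert! (Θ.isOneParam_chi i).smul (c / (2 * Real.pi * Complex.I)) using 5
  have : (Real.pi : ℂ) ≠ 0 := by exact_mod_cast Real.pi_ne_zero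
  field_simp

/-- The element of the circle group `T` with coordinates `e^{√-1 x_i}`. -/
theorem TorusCoords.iso_exp (x : Fin k → ℝ) :
    (Θ.iso (fun i => Circle.exp (x i)) : G) = Θ.Θ (fun i => expUnit (x i * Complex.I)) := by
  rw [← Θ.extend]
  simp only [toUnits_exp]

variable [LieGroup 𝓘(ℂ, E) ω G]

theorem TorusCoords.contMDiff_comp {F M : Type*} [NormedAddCommGroup F] [NormedSpace ℂ F]
    [TopologicalSpace M] [ChartedSpace F M] {f : M → Fin k → ℂˣ}
    (h : ∀ i, ContMDiff 𝓘(ℂ, F) 𝓘(ℂ, ℂ) ω (fun x => f x i)) :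
    ContMDiff 𝓘(ℂ, F) 𝓘(ℂ, E) ω (fun x => Θ.Θ (f x)) :=
  Θ.induction_components (ContMDiff 𝓘(ℂ, F) 𝓘(ℂ, E) ω) contMDiff_const
    (fun _ _ hf hg => hf.mul hg) f fun i => (Θ.holo i).comp (h i)

theorem TorusCoords.continuous : Continuous Θ.Θ := by
  have := topologicalGroup_of_lieGroup 𝓘(ℂ, E) (G := G) ω
  exact Θ.induction_components Continuous continuous_const (fun _ _ hf hg => hf.mul hg) id
    fun i => (Θ.holo i).continuous.comp (continuous_apply i)

/-- The map `w ↦ Θ(e^{c_1 w}, …, e^{c_k w})` is the one-parameter subgroup with velocity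
`∑ c_i/(2π√-1) χ_i`. -/
theorem TorusCoords.isOneParam_exp (c : Fin k → ℂ) :
    IsOneParam (∑ i, (c i / (2 * Real.pi * Complex.I)) • Θ.chi i)
      (fun w => Θ.Θ (fun i => expUnit (c i * w))) := by
  classical
  have key : ∀ s : Finset (Fin k),
      IsOneParam (∑ i ∈ s, (c i / (2 * Real.pi * Complex.I)) • Θ.chi i)
        (fun w => Θ.Θ (fun i => if i ∈ s then expUnit (c i * w) else 1)) := by
    intro s
    induction s using Finset.induction_on with
    | empty =>
      convert! isOneParam_one (E := E) (G := G) using 2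
      exact map_one Θ.Θ
    | insert i s hi ih =>
      rw [Finset.sum_insert hi]
      convert! (Θ.isOneParam_mulSingle i (c i)).mul ih fun _ _ => Θ.commute _ _ using 2 with w
      rw [← map_mul]
      congr 1
      funext j
      rcases eq_or_ne j i with rfl | hj
      · simp [hi]
      · simp [hj]
  simpa using key Finset.univ

/-- A one-parameter subgroup with velocity in `Lie(T)` commutes with the complexification of
`T`. -/
theorem TorusCoords.commute_oneParam (hT : ∀ s ∈ T, ∀ t ∈ T, s * t = t * s)
    {v : GroupLieAlgebra 𝓘(ℂ, E) G} {γ : ℂ → G} (h : IsOneParam v γ) (hγ : ∀ t : ℝ, γ t ∈ T)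
    (z : ℂ) (u : Fin k → ℂˣ) : Commute (γ z) (Θ.Θ u) := by
  have : u ∈ (Subgroup.centralizer {γ z}).comap Θ.Θ := by
    refine Subgroup.pi_mem_of_mulSingle_mem u fun i => ?_
    rw [Subgroup.mem_comap, Subgroup.mem_centralizer_singleton_iff]
    -- at real times the `i`-th factor of `(ℂˣ)ᵏ` gives points of the commutative group `T`
    have hc := h.commute (Θ.isOneParam_mulSingle i Complex.I) (fun s t => by
      refine hT _ (hγ s) _ ?_
      have := Θ.iso_exp (Pi.single i t)
      convert! (Θ.iso (fun j => Circle.exp ((Pi.single i t : Fin k → ℝ) j))).2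
      rw [this]
      congr 1
      funext j
      rcases eq_or_ne j i with rfl | hj
      · simp [mul_comm]
      · simp [hj, expUnit_zero]) z (Complex.log (u i) / Complex.I)
    rw [mul_div_cancel₀ _ Complex.I_ne_zero, expUnit_log] at hc
    exact hc.eq.symm
  rw [Subgroup.mem_comap, Subgroup.mem_centralizer_singleton_iff] at this
  exact this.symm

/-- The coefficients of `λ`, in the normalization of `TorusCoords.isOneParam_exp`. -/
theorem lam_coeff (a : ℤ) : Complex.I / (2 * Real.pi) * (a : ℂ)
    = (-a : ℂ) / (2 * Real.pi * Complex.I) := by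
  have hpi : (Real.pi : ℂ) ≠ 0 := by exact_mod_cast Real.pi_ne_zero
  field_simp
  rw [Complex.I_sq]
  ring

/-- The vectors `χ_i` are linearly independent over the integers. -/
theorem TorusCoords.chi_coeff_unique {a b : Fin k → ℤ}
    (h : ∑ i, (Complex.I / (2 * Real.pi) * (a i : ℂ)) • Θ.chi i
      = ∑ i, (Complex.I / (2 * Real.pi) * (b i : ℂ)) • Θ.chi i) : a = b := by
  simp only [lam_coeff] at h
  have h1 := Θ.isOneParam_exp (fun i => (-a i : ℂ))
  have h2 := Θ.isOneParam_exp (fun i => (-b i : ℂ))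
  rw [h] at h1
  have e := h1.unique h2
  -- imaginary times give points of the circle group, on which `iso` is injective
  have key : ∀ (t : ℝ) (i : Fin k), Circle.exp (a i * t) = Circle.exp (b i * t) := by
    intro t
    have := congrFun e (-t * Complex.I)
    have := congrFun (Θ.iso.injective (a₁ := fun i => Circle.exp (a i * t))
      (a₂ := fun i => Circle.exp (b i * t)) (Subtype.ext ?_))
    · exact this
    · rw [Θ.iso_exp, Θ.iso_exp]
      convert! this using 4 with i i
      all_goals push_cast; ring
  -- at `t = π / (a_i - b_i)` the two sides differ by the factor `-1`
  funext i
  by_contra hne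
  have hne' : ((a i : ℝ) - b i) ≠ 0 := sub_ne_zero.2 (by exact_mod_cast hne)
  have h3 := key (Real.pi / (a i - b i)) i
  rw [← div_eq_one, ← Circle.exp_sub, ← sub_mul, mul_div_cancel₀ _ hne'] at h3
  exact Circle.exp_pi_ne_one h3

/-- Elements of the cocharacter lattice are integral combinations of the `χ_i`. -/
theorem TorusCoords.exists_coeff {v : GroupLieAlgebra 𝓘(ℂ, E) G} (hv : v ∈ cocharLattice E T) :
    ∃ n : Fin k → ℤ, v = ∑ i, (n i : ℂ) • Θ.chi i := by
  obtain ⟨⟨γ, h, hγ⟩, h1⟩ := hv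
  rw [h.lieExp_eq] at h1
  let f : ℝ → Fin k → Circle := fun t => Θ.iso.symm ⟨γ t, hγ t⟩
  have hf : Continuous f := Θ.iso.symm.continuous.comp
    ((h.holo.continuous.comp Complex.continuous_ofReal).subtype_mk _)
  have fadd : ∀ s t, f (s + t) = f s * f t := fun s t => by
    simp only [f, ← map_mul]
    congr 1
    ext
    simp [h.add]
  have f1 : f 1 = 1 := by
    simp only [f]
    rw [← map_one Θ.iso.symm]
    congr 1
    ext
    simp [h1]
  choose n hn using fun i => Circle.exists_eq_exp_of_continuous_hom
    ((continuous_apply i).comp hf) (fun s t => congrFun (fadd s t) i) (congrFun f1 i)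
  refine ⟨n, ?_⟩
  have hpi : (Real.pi : ℂ) ≠ 0 := by exact_mod_cast Real.pi_ne_zero
  have h2 := Θ.isOneParam_exp (fun i => (n i : ℂ) * (2 * Real.pi * Complex.I))
  have hc : ∀ i, (n i : ℂ) * (2 * Real.pi * Complex.I) / (2 * Real.pi * Complex.I) = n i :=
    fun i => mul_div_cancel_right₀ _ (by simp [hpi])
  simp only [hc] at h2
  refine (h.eq_of_real h2 fun t => ?_).1
  have h3 : (Θ.iso (f t) : G) = γ t := by simp [f]
  have h4 : f t = fun i => Circle.exp (2 * Real.pi * n i * t) := funext fun i => hn i t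
  rw [← h3, h4, Θ.iso_exp]
  congr 1
  funext i
  congr 1
  push_cast
  ring

theorem TorusCoords.existsUnique_coeff {lam : GroupLieAlgebra 𝓘(ℂ, E) G}
    (h : (2 * Real.pi * Complex.I : ℂ) • lam ∈ cocharLattice E T) :
    ∃! a : Fin k → ℤ, lam = ∑ i, (Complex.I / (2 * Real.pi) * (a i : ℂ)) • Θ.chi i := by
  obtain ⟨n, hn⟩ := Θ.exists_coeff h
  have hpi : (Real.pi : ℂ) ≠ 0 := by exact_mod_cast Real.pi_ne_zero
  have e : lam = ∑ i, (Complex.I / (2 * Real.pi) * ((-n) i : ℤ)) • Θ.chi i := by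
    have := congrArg (fun w => (2 * Real.pi * Complex.I : ℂ)⁻¹ • w) hn
    simp only [inv_smul_smul₀ (show (2 * Real.pi * Complex.I : ℂ) ≠ 0 by simp [hpi])] at this
    rw [this, Finset.smul_sum]
    refine Finset.sum_congr rfl fun i _ => ?_
    rw [smul_smul, lam_coeff]
    congr 1
    simp only [Pi.neg_apply]
    push_cast
    field_simp
  exact ⟨-n, e, fun b hb => Θ.chi_coeff_unique (hb.symm.trans e)⟩

/-- `t^{α}` commutes with the complexified torus for `α ∈ √-1 Lie(T)`. -/
theorem TorusCoords.commute_lieRpow (hT : ∀ s ∈ T, ∀ t ∈ T, s * t = t * s)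
    {α : GroupLieAlgebra 𝓘(ℂ, E) G} (hα : α ∈ imSubLie E T) (t : ℝ) (u : Fin k → ℂˣ) :
    Commute (lieRpow t α) (Θ.Θ u) := by
  obtain ⟨v, ⟨γ, h, hγ⟩, rfl⟩ := hα
  rw [lieRpow, smul_smul, h.lieExp_smul]
  exact Θ.commute_oneParam hT h hγ _ u

/-- `t^{α + λ} = t^α · Θ(t^{-a})` for `λ = ∑ (√-1/2π) a_i χ_i`. -/
theorem TorusCoords.lieRpow_add (hT : ∀ s ∈ T, ∀ t ∈ T, s * t = t * s)
    {α lam : GroupLieAlgebra 𝓘(ℂ, E) G} (hα : α ∈ imSubLie E T) {a : Fin k → ℤ}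
    (ha : lam = ∑ i, (Complex.I / (2 * Real.pi) * (a i : ℂ)) • Θ.chi i) (t : ℝ) :
    lieRpow t (α + lam) = lieRpow t α * Θ.Θ (fun i => expUnit (-a i * Real.log t)) := by
  obtain ⟨v, ⟨γ, h, hγ⟩, rfl⟩ := hα
  simp only [lam_coeff] at ha
  have h2 := Θ.isOneParam_exp (fun i => (-a i : ℂ))
  rw [← ha] at h2
  have h3 := (h.smul Complex.I).mul h2 fun y z => Θ.commute_oneParam hT h hγ _ _
  rw [lieRpow, h3.lieExp_smul, lieRpow, (h.smul Complex.I).lieExp_smul]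

end Torus

end Parahoric

namespace Parahoric

/-! ### Local analysis at the marked points -/

section Local

variable {X : Type u} [TopologicalSpace X] [ChartedSpace ℂ X]
  {r : ℕ} (D : Marking X r)

theorem Marking.coord_ne_zero (j : Fin r) {p : X} (hp : p ∈ (D.coord j).source)
    (hne : p ≠ D.pt j) : D.coord j p ≠ 0 := fun h =>
  hne ((D.coord j).injOn hp (D.pt_mem j) (h.trans (D.coord_pt j).symm))

theorem Marking.eventually_coord_ne_zero (j : Fin r) :
    ∀ᶠ p in 𝓝[≠] (D.pt j), D.coord j p ≠ 0 := by
  filter_upwards [self_mem_nhdsWithin, mem_nhdsWithin_of_mem_nhds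
    ((D.coord j).open_source.mem_nhds (D.pt_mem j))] with p h1 h2
  exact D.coord_ne_zero j h2 h1

theorem Marking.tendsto_coord (j : Fin r) :
    Filter.Tendsto (D.coord j) (𝓝 (D.pt j)) (𝓝 0) := by
  have := ((D.coord j).continuousAt (D.pt_mem j)).tendsto
  rwa [D.coord_pt] at this

theorem isCompact_units_annulus {m M : ℝ} (hm : 0 < m) :
    IsCompact {u : ℂˣ | m ≤ ‖(u : ℂ)‖ ∧ ‖(u : ℂ)‖ ≤ M} := by
  have hK : IsCompact {z : ℂ | m ≤ ‖z‖ ∧ ‖z‖ ≤ M} := by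
    refine (isCompact_closedBall (0 : ℂ) M).of_isClosed_subset ?_ fun z hz => by simpa using hz.2
    exact (isClosed_le continuous_const continuous_norm).inter
      (isClosed_le continuous_norm continuous_const)
  refine Units.isOpenEmbedding_val.isInducing.isCompact_preimage' hK fun z hz => ?_
  exact ⟨Units.mk0 z (norm_pos_iff.1 (hm.trans_le hz.1)), rfl⟩

theorem Marking.contMDiffOn_coord (j : Fin r) :
    ContMDiffOn 𝓘(ℂ, ℂ) 𝓘(ℂ, ℂ) ω (D.coord j) (D.coord j).source :=
  contMDiffOn_of_mem_maximalAtlas (D.coord_mem j)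

theorem Marking.contMDiffAt_coord (j : Fin r) {p : X} (hp : p ∈ (D.coord j).source) :
    ContMDiffAt 𝓘(ℂ, ℂ) 𝓘(ℂ, ℂ) ω (D.coord j) p :=
  (D.contMDiffOn_coord j).contMDiffAt ((D.coord j).open_source.mem_nhds hp)

theorem contMDiffAt_comp_coord {j : Fin r} {p : X} (hp : p ∈ (D.coord j).source) {g : ℂ → ℂ}
    (hg : AnalyticAt ℂ g (D.coord j p)) :
    ContMDiffAt 𝓘(ℂ, ℂ) 𝓘(ℂ, ℂ) ω (fun x => g (D.coord j x)) p :=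
  ContMDiffAt.comp (I' := 𝓘(ℂ, ℂ)) p hg.contDiffAt.contMDiffAt (D.contMDiffAt_coord j hp)

theorem contMDiff_val_units {F M : Type*} [NormedAddCommGroup F] [NormedSpace ℂ F]
    [TopologicalSpace M] [ChartedSpace F M] {f : M → ℂˣ}
    (h : ContMDiff 𝓘(ℂ, F) 𝓘(ℂ, ℂ) ω f) :
    ContMDiff 𝓘(ℂ, F) 𝓘(ℂ, ℂ) ω (fun x => (f x : ℂ)) :=
  Units.contMDiff_val.comp h

variable [T2Space X]

theorem Marking.eventually_mem_punct {U : Opens X} {j : Fin r} (hj : D.pt j ∈ U) :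
    ∀ᶠ p in 𝓝[≠] (D.pt j), p ∈ D.punct U := by
  have h : (Set.range D.pt \ {D.pt j})ᶜ ∈ 𝓝 (D.pt j) :=
    ((Set.finite_range D.pt).sdiff).isClosed.isOpen_compl.mem_nhds (by simp)
  filter_upwards [self_mem_nhdsWithin, mem_nhdsWithin_of_mem_nhds h,
    mem_nhdsWithin_of_mem_nhds (U.isOpen.mem_nhds hj)] with p h1 h2 h3
  exact ⟨h3, fun h => h2 ⟨h, h1⟩⟩

variable {k : ℕ} {a : Fin r → Fin k → ℤ}

/-- Near `x_j`, a section of `ℒ*` is `|z_j|^{-a_j}` up to a factor in a compact subset of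
`(ℂˣ)ᵏ`. -/
theorem LStar.exists_compact {U : Opens X} (l : LStar D a U) {j : Fin r} (hj : D.pt j ∈ U) :
    ∃ C : Set (Fin k → ℂˣ), IsCompact C ∧ ∀ᶠ p in 𝓝[≠] (D.pt j), ∀ hp : p ∈ D.punct U,
      (fun i => expUnit (-a j i * Real.log ‖D.coord j p‖))⁻¹ * l.1 ⟨p, hp⟩ ∈ C := by
  choose g hg hg0 hl using fun i => l.2.2 i j hj
  refine ⟨Set.univ.pi fun i => {u : ℂˣ | ‖g i 0‖ / 2 ≤ ‖(u : ℂ)‖ ∧ ‖(u : ℂ)‖ ≤ 2 * ‖g i 0‖},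
    isCompact_univ_pi fun i => isCompact_units_annulus (half_pos (norm_pos_iff.2 (hg0 i))), ?_⟩
  have hbd : ∀ᶠ p in 𝓝[≠] (D.pt j), ∀ i, ‖g i 0‖ / 2 ≤ ‖g i (D.coord j p)‖ ∧
      ‖g i (D.coord j p)‖ ≤ 2 * ‖g i 0‖ := by
    refine Filter.eventually_all.2 fun i => ?_
    have ht : Filter.Tendsto (fun p => ‖g i (D.coord j p)‖) (𝓝[≠] (D.pt j)) (𝓝 ‖g i 0‖) :=
      ((hg i).continuousAt.norm.tendsto.comp (D.tendsto_coord j)).mono_left nhdsWithin_le_nhds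
    have hpos := norm_pos_iff.2 (hg0 i)
    filter_upwards [ht.eventually_mem (Icc_mem_nhds (half_lt_self hpos)
      (show ‖g i 0‖ < 2 * ‖g i 0‖ by linarith))] with p hp
    exact hp
  filter_upwards [hbd, Filter.eventually_all.2 hl, D.eventually_coord_ne_zero j] with p h1 h2 h3 hp
  refine Set.mem_univ_pi.2 fun i => ?_
  have e : ‖((((fun i => expUnit (-a j i * Real.log ‖D.coord j p‖))⁻¹ * l.1 ⟨p, hp⟩) i : ℂˣ) : ℂ)‖
      = ‖g i (D.coord j p)‖ := by
    have hpos := norm_pos_iff.2 h3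
    have : ‖((expUnit (-a j i * Real.log ‖D.coord j p‖) : ℂˣ) : ℂ)‖
        = ‖D.coord j p‖ ^ (-a j i) := by
      rw [expUnit, Units.val_mk0, Complex.norm_exp, ← Real.rpow_intCast,
        Real.rpow_def_of_pos hpos]
      congr 1
      have : (-(a j i : ℂ) * (Real.log ‖D.coord j p‖ : ℂ))
          = ((-(a j i : ℝ) * Real.log ‖D.coord j p‖ : ℝ) : ℂ) := by push_cast; ring
      rw [this, Complex.ofReal_re]
      push_cast
      ring
    simp only [Pi.mul_apply, Pi.inv_apply, Units.val_mul, norm_mul, Units.val_inv_eq_inv_val,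
      norm_inv, h2 i hp, norm_zpow]
    rw [this, ← mul_assoc, inv_mul_cancel₀ (zpow_ne_zero _ hpos.ne'), one_mul]
  simp only [Set.mem_ofPred_eq, e]
  exact h1 i

/-- The quotient of two sections of `ℒ*` extends over the marked points to a nowhere vanishing
holomorphic function. -/
theorem LStar.exists_quotient {U : Opens X} (l l' : LStar D a U) :
    ∃ ψ : U → Fin k → ℂˣ, (∀ i, ContMDiff 𝓘(ℂ, ℂ) 𝓘(ℂ, ℂ) ω (fun p => ψ p i)) ∧
      ∀ p : D.punct U, l'.1 p = l.1 p * ψ ⟨p.1, D.punct_le U p.2⟩ := by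
  classical
  suffices h : ∀ i, ∃ F : X → ℂ, (∀ p ∈ U, F p ≠ 0 ∧ ContMDiffAt 𝓘(ℂ, ℂ) 𝓘(ℂ, ℂ) ω F p) ∧
      ∀ p : D.punct U, F p = (l'.1 p i : ℂ) / (l.1 p i : ℂ) by
    choose F hF hF' using h
    refine ⟨fun p i => Units.mk0 (F i p) (hF i p p.2).1, fun i => contMDiff_units fun p => ?_,
      fun p => funext fun i => Units.ext ?_⟩
    · exact contMDiffAt_subtype_iff.2 (hF i p p.2).2
    · simp only [Pi.mul_apply, Units.val_mul, Units.val_mk0, hF']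
      field_simp
  intro i
  have h : ∀ j, ∃ q : ℂ → ℂ, D.pt j ∈ U → AnalyticAt ℂ q 0 ∧ q 0 ≠ 0 ∧
      ∀ᶠ p in 𝓝[≠] (D.pt j), ∀ hp : p ∈ D.punct U,
        (l'.1 ⟨p, hp⟩ i : ℂ) / (l.1 ⟨p, hp⟩ i : ℂ) = q (D.coord j p) := by
    intro j
    by_cases hj : D.pt j ∈ U
    · obtain ⟨g, hg, hg0, hl⟩ := l.2.2 i j hj
      obtain ⟨g', hg', hg0', hl'⟩ := l'.2.2 i j hj
      refine ⟨fun z => g' z / g z, fun _ => ⟨hg'.div hg hg0, div_ne_zero hg0' hg0, ?_⟩⟩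
      filter_upwards [hl, hl', D.eventually_coord_ne_zero j] with p h1 h2 h3 hp
      rw [h1, h2, mul_div_mul_left _ _ (zpow_ne_zero _ h3)]
    · exact ⟨0, fun h => (hj h).elim⟩
  choose q hq using h
  -- the quotient of the units `g'` and `g` supplies the value at a marked point
  let F : X → ℂ := fun p => if hp : p ∈ D.punct U then (l'.1 ⟨p, hp⟩ i : ℂ) / (l.1 ⟨p, hp⟩ i : ℂ)
    else if h : ∃ j, D.pt j = p then q h.choose 0 else 1
  have Fp : ∀ p : D.punct U, F p = (l'.1 p i : ℂ) / (l.1 p i : ℂ) := fun p => dif_pos p.2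
  have Fpt : ∀ j, F (D.pt j) = q j 0 := fun j => by
    have h : ∃ j', D.pt j' = D.pt j := ⟨j, rfl⟩
    simp only [F]
    rw [dif_neg fun hp => hp.2 ⟨j, rfl⟩, dif_pos h, D.inj h.choose_spec]
  refine ⟨F, fun p hp => ?_, Fp⟩
  by_cases hr : p ∈ Set.range D.pt
  · obtain ⟨j, rfl⟩ := hr
    obtain ⟨q1, q2, q3⟩ := hq j hp
    refine ⟨by rwa [Fpt], ?_⟩
    refine (contMDiffAt_comp_coord D (D.pt_mem j) (by rwa [D.coord_pt])).congr_of_eventuallyEq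
      (f := fun x => q j (D.coord j x)) ?_
    have h := q3.and (D.eventually_mem_punct hp)
    rw [eventually_nhdsWithin_iff] at h
    filter_upwards [h] with x hx
    by_cases hxj : x = D.pt j
    · rw [hxj, Fpt, D.coord_pt]
    · obtain ⟨h1, h2⟩ := hx hxj
      rw [Fp ⟨x, h2⟩, h1]
  · have hp' : p ∈ D.punct U := ⟨hp, hr⟩
    refine ⟨by rw [Fp ⟨p, hp'⟩]; simp, ?_⟩
    refine (contMDiffAt_subtype_iff (U := D.punct U) (x := ⟨p, hp'⟩)).1 ?_
    simp only [Fp]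
    have h1 := contMDiff_val_units (l'.2.1 i)
    have h2 := contMDiff_val_units (l.2.1 i)
    exact (h1 ⟨p, hp'⟩).div₀ (h2 ⟨p, hp'⟩) (Units.ne_zero _)

variable (a) in
/-- `ℒ*` has local sections: `z_j^{-a_j}` near `x_j`, and `1` away from the marked points. -/
theorem LStar.exists_local (x : X) : ∃ U : Opens X, x ∈ U ∧ Nonempty (LStar D a U) := by
  by_cases hx : x ∈ Set.range D.pt
  · obtain ⟨j, rfl⟩ := hx
    let U : Opens X := ⟨(D.coord j).source ∩ (Set.range D.pt \ {D.pt j})ᶜ,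
      (D.coord j).open_source.inter ((Set.finite_range D.pt).sdiff).isClosed.isOpen_compl⟩
    have hne : ∀ p : D.punct U, D.coord j p ≠ 0 := fun p =>
      D.coord_ne_zero j p.2.1.1 fun h => p.2.2 ⟨j, h.symm⟩
    refine ⟨U, ⟨D.pt_mem j, by simp⟩,
      ⟨fun p i => Units.mk0 (D.coord j p ^ (-a j i)) (zpow_ne_zero _ (hne p)), fun i => ?_,
        fun i j' hj' => ?_⟩⟩
    · refine contMDiff_units fun p => ?_
      refine contMDiffAt_subtype_iff.2 (contMDiffAt_comp_coord D p.2.1.1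
        (g := fun z => z ^ (-a j i)) ?_)
      exact analyticAt_id.zpow (hne p)
    · obtain rfl : j' = j := by
        by_contra h
        exact hj'.2 ⟨⟨j', rfl⟩, fun h' => h (D.inj h')⟩
      exact ⟨fun _ => 1, analyticAt_const, one_ne_zero,
        Filter.Eventually.of_forall fun p hp => by simp⟩
  · exact ⟨⟨(Set.range D.pt)ᶜ, (Set.finite_range D.pt).isClosed.isOpen_compl⟩, hx,
      ⟨fun _ _ => 1, fun _ => contMDiff_const, fun _ j hj => (hj ⟨j, rfl⟩).elim⟩⟩

end Local

/-! ### Conjugation by sections of `ℒ*` -/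

section Conj

variable {X : Type u} [TopologicalSpace X] [T2Space X] [ChartedSpace ℂ X]
  {r : ℕ} (D : Marking X r)
  {E : Type*} [NormedAddCommGroup E] [NormedSpace ℂ E]
  {G : Type u} [Group G] [TopologicalSpace G] [ChartedSpace E G] [LieGroup 𝓘(ℂ, E) ω G]
  {T : Subgroup G} {k : ℕ} (Θ : TorusCoords E T k) {a : Fin r → Fin k → ℤ}

/-- A nowhere vanishing holomorphic function on `U` with values in `(ℂˣ)ᵏ` gives a section of
`𝒢_α`, as the torus commutes with `|z_j|^{α_j}`. -/
theorem TorusCoords.comp_mem_parahoricSections {α : Fin r → GroupLieAlgebra 𝓘(ℂ, E) G}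
    (hα : ∀ j t u, Commute (lieRpow t (α j)) (Θ.Θ u)) {U : Opens X} {ψ : U → Fin k → ℂˣ}
    (hψ : ∀ i, ContMDiff 𝓘(ℂ, ℂ) 𝓘(ℂ, ℂ) ω (fun p => ψ p i)) :
    (fun p : D.punct U => Θ.Θ (ψ ⟨p.1, D.punct_le U p.2⟩)) ∈ parahoricSections D α U := by
  have h := Θ.contMDiff_comp hψ
  refine ⟨h.comp (contMDiff_inclusion (D.punct_le U)), fun j hj => ?_⟩
  have : LocallyCompactSpace X := ChartedSpace.locallyCompactSpace ℂ X
  obtain ⟨K, hK, hjK, hKU⟩ := exists_compact_subset U.isOpen hj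
  have hK' : IsCompact ((↑) ⁻¹' K : Set U) :=
    U.isOpen.isOpenEmbedding_subtypeVal.isInducing.isCompact_preimage' hK (by simpa using hKU)
  refine ⟨_, hK'.image h.continuous, ?_⟩
  filter_upwards [mem_nhdsWithin_of_mem_nhds (mem_interior_iff_mem_nhds.1 hjK)] with p hpK hp
  rw [mul_assoc, ← (hα j _ _).eq, inv_mul_cancel_left]
  exact ⟨⟨p, D.punct_le U hp⟩, hpK, rfl⟩

/-- Conjugation by `Θ(l)` translates the weight by `λ`: up to a bounded factor, `Θ(l)` is
`|z_j|^{λ_j}` near `x_j`, and it commutes with `|z_j|^{α_j}`. -/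
theorem TorusCoords.conj_mem_iff (hT : ∀ s ∈ T, ∀ t ∈ T, s * t = t * s)
    {α lam : Fin r → GroupLieAlgebra 𝓘(ℂ, E) G} (hα : ∀ j, α j ∈ imSubLie E T)
    (ha : ∀ j, lam j = ∑ i, (Complex.I / (2 * Real.pi) * (a j i : ℂ)) • Θ.chi i)
    {U : Opens X} (l : LStar D a U) (φ : D.punct U → G) :
    φ ∈ parahoricSections D α U ↔
      (fun p => Θ.Θ (l.1 p) * φ p * (Θ.Θ (l.1 p))⁻¹) ∈ parahoricSections D (α + lam) U := by
  have := topologicalGroup_of_lieGroup 𝓘(ℂ, E) (G := G) ω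
  have hl : ContMDiff 𝓘(ℂ, ℂ) 𝓘(ℂ, E) ω (fun p => Θ.Θ (l.1 p)) := Θ.contMDiff_comp l.2.1
  have key : ∀ (j : Fin r) (p : D.punct U),
      (lieRpow ‖D.coord j p‖ ((α + lam) j))⁻¹ * (Θ.Θ (l.1 p) * φ p * (Θ.Θ (l.1 p))⁻¹)
          * lieRpow ‖D.coord j p‖ ((α + lam) j)
        = Θ.Θ ((fun i => expUnit (-a j i * Real.log ‖D.coord j p‖))⁻¹ * l.1 p)
          * ((lieRpow ‖D.coord j p‖ (α j))⁻¹ * φ p * lieRpow ‖D.coord j p‖ (α j))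
          * (Θ.Θ ((fun i => expUnit (-a j i * Real.log ‖D.coord j p‖))⁻¹ * l.1 p))⁻¹ := by
    intro j p
    rw [Pi.add_apply, Θ.lieRpow_add hT (hα j) (ha j), map_mul, map_inv]
    have hc := (Θ.commute_lieRpow hT (hα j) ‖D.coord j p‖ (l.1 p))
    have h1 := hc.inv_left.eq
    have h2 := hc.inv_right.eq
    simp only [mul_inv_rev, inv_inv, mul_assoc]
    rw [← mul_assoc (lieRpow _ _)⁻¹ (Θ.Θ (l.1 p)), h1, ← mul_assoc (Θ.Θ (l.1 p))⁻¹, ← h2]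
    simp only [mul_assoc]
  constructor
  · rintro ⟨h1, h2⟩
    refine ⟨(hl.mul h1).mul hl.inv, fun j hj => ?_⟩
    obtain ⟨K, hK, hφ⟩ := h2 j hj
    obtain ⟨C, hC, hlC⟩ := l.exists_compact D hj
    refine ⟨(fun q : (Fin k → ℂˣ) × G => Θ.Θ q.1 * q.2 * (Θ.Θ q.1)⁻¹) '' (C ×ˢ K),
      (hC.prod hK).image ?_, ?_⟩
    · have := Θ.continuous
      fun_prop
    · filter_upwards [hφ, hlC] with p hp1 hp2 hp
      rw [key j ⟨p, hp⟩]
      exact ⟨(_, _), ⟨hp2 hp, hp1 hp⟩, rfl⟩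
  · rintro ⟨h1, h2⟩
    refine ⟨?_, fun j hj => ?_⟩
    · convert! (hl.inv.mul h1).mul hl using 1
      funext p
      simp [mul_assoc]
    obtain ⟨K, hK, hφ⟩ := h2 j hj
    obtain ⟨C, hC, hlC⟩ := l.exists_compact D hj
    refine ⟨(fun q : (Fin k → ℂˣ) × G => (Θ.Θ q.1)⁻¹ * q.2 * Θ.Θ q.1) '' (C ×ˢ K),
      (hC.prod hK).image ?_, ?_⟩
    · have := Θ.continuous
      fun_prop
    · filter_upwards [hφ, hlC] with p hp1 hp2 hp
      have h3 := hp1 hp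
      rw [key j ⟨p, hp⟩] at h3
      exact ⟨(_, _), ⟨hp2 hp, h3⟩, by group⟩

end Conj

end Parahoric

theorem CategoryTheory.sheafifyMap_sheafifyLift_comm {C : Type*} [Category* C]
    {J : GrothendieckTopology C} {A : Type*} [Category* A] [HasWeakSheafify J A]
    {P Q P' Q' : Cᵒᵖ ⥤ A} {η : P ⟶ P'} {η' : Q ⟶ Q'} (hP' : Presheaf.IsSheaf J P')
    (hQ' : Presheaf.IsSheaf J Q') {f : P ⟶ Q} {g : P' ⟶ Q'} (h : f ≫ η' = η ≫ g) :
    sheafifyMap J f ≫ sheafifyLift J η' hQ' = sheafifyLift J η hP' ≫ g := by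
  refine sheafify_hom_ext J _ _ hQ' ?_
  rw [← toSheafify_naturality_assoc, toSheafify_sheafifyLift, toSheafify_sheafifyLift_assoc, h]

namespace Parahoric

/-! ### The Hecke transformation as a twist -/

section Hecke

variable {X : Type u} [TopologicalSpace X] [T2Space X] [ChartedSpace ℂ X]
  {r : ℕ} {D : Marking X r}
  {E : Type*} [NormedAddCommGroup E] [NormedSpace ℂ E]
  {G : Type u} [Group G] [TopologicalSpace G] [ChartedSpace E G] [LieGroup 𝓘(ℂ, E) ω G]
  {T : Subgroup G} {k : ℕ} (Θ : TorusCoords E T k) {a : Fin r → Fin k → ℤ}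
  {α β : Fin r → GroupLieAlgebra 𝓘(ℂ, E) G}

/-- The section `Θ(l⁻¹ l')` of `𝒢_α` attached to two sections `l`, `l'` of `ℒ*`. -/
def TorusCoords.transition (hα : ∀ j t u, Commute (lieRpow t (α j)) (Θ.Θ u)) {U : Opens X}
    (l l' : LStar D a U) : parahoricSections D α U :=
  ⟨fun p => Θ.Θ ((l.1 p)⁻¹ * l'.1 p), by
    obtain ⟨ψ, hψ, e⟩ := l.exists_quotient D l'
    convert! Θ.comp_mem_parahoricSections D hα hψ using 3 with p
    rw [e, inv_mul_cancel_left]⟩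

/-- Conjugation by `Θ(l)`, as an isomorphism `𝒢_α(U) ≃ 𝒢_β(U)`. -/
def TorusCoords.conjEquiv {U : Opens X} (l : LStar D a U)
    (h : ∀ φ : D.punct U → G, φ ∈ parahoricSections D α U ↔
      (fun p => Θ.Θ (l.1 p) * φ p * (Θ.Θ (l.1 p))⁻¹) ∈ parahoricSections D β U) :
    parahoricSections D α U ≃* parahoricSections D β U where
  toFun φ := ⟨fun p => Θ.Θ (l.1 p) * φ.1 p * (Θ.Θ (l.1 p))⁻¹, (h φ.1).1 φ.2⟩
  invFun μ := ⟨fun p => (Θ.Θ (l.1 p))⁻¹ * μ.1 p * Θ.Θ (l.1 p), (h _).2 (by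
    convert! μ.2 using 1
    funext p
    group)⟩
  left_inv φ := Subtype.ext (funext fun p => by group)
  right_inv μ := Subtype.ext (funext fun p => by group)
  map_mul' φ ψ := Subtype.ext (funext fun p => by
    simp only [Subgroup.coe_mul, Pi.mul_apply]
    group)

/-- The identification of `𝒢_α` with `𝒢_β` by conjugation with sections of `ℒ*`. -/
def TorusCoords.heckeTwist (hα : ∀ j t u, Commute (lieRpow t (α j)) (Θ.Θ u))
    (h : ∀ (U : Opens X) (l : LStar D a U) (φ : D.punct U → G), φ ∈ parahoricSections D α U ↔
      (fun p => Θ.Θ (l.1 p) * φ p * (Θ.Θ (l.1 p))⁻¹) ∈ parahoricSections D β U) :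
    SheafTorsor.Twist (parahoricSheaf D α) (parahoricSheaf D β) where
  L U := LStar D a U
  res h l := LStar.res D h l
  res_res _ _ _ := rfl
  res_self _ _ := rfl
  conj {U} l := Θ.conjEquiv l (h U l)
  trans l l' := Θ.transition hα l l'
  conj_res _ _ _ := rfl
  trans_res _ _ _ := rfl
  trans_mul l l' l'' := Subtype.ext (funext fun p => by
    change Θ.Θ ((l.1 p)⁻¹ * l'.1 p) * Θ.Θ ((l'.1 p)⁻¹ * l''.1 p) = Θ.Θ ((l.1 p)⁻¹ * l''.1 p)
    rw [← map_mul]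
    congr 1
    group)
  conj_trans l l' φ := Subtype.ext (funext fun p => by
    change Θ.Θ (l'.1 p) * φ.1 p * (Θ.Θ (l'.1 p))⁻¹
      = Θ.Θ (l.1 p) * (Θ.Θ ((l.1 p)⁻¹ * l'.1 p) * φ.1 p * Θ.Θ ((l'.1 p)⁻¹ * l.1 p))
        * (Θ.Θ (l.1 p))⁻¹
    simp only [map_mul, map_inv]
    group)
  exists_mem x := LStar.exists_local D a x

/-- The relation defining `ℰ ⊗ ℒ*` identifies `(ε, l)` exactly with the pairs
`(ε · Θ(l⁻¹ l'), l')`. -/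
theorem heckeRel_iff (hα : ∀ j t u, Commute (lieRpow t (α j)) (Θ.Θ u)) (ℰ : ParahoricBundle D α)
    {U : Opens X} (s t : ℰ.sheaf.presheaf.obj (op U) × LStar D a U) :
    heckeRel Θ a ℰ U s t ↔ t.1 = ℰ.act s.1 (Θ.transition hα s.2 t.2) := by
  constructor
  · rintro ⟨ψ, g, h1, h2, h3, h4⟩
    rw [h4]
    congr 1
    refine Subtype.ext (funext fun p => ?_)
    change (g.1 p)⁻¹ = Θ.Θ ((s.2.1 p)⁻¹ * t.2.1 p)
    rw [h2, h3, ← map_inv]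
    congr 1
    rw [mul_comm (t.2.1 p), mul_inv_rev, mul_comm _ (ψ _)⁻¹, inv_mul_cancel_right]
  · intro h
    obtain ⟨ψ, hψ, e⟩ := t.2.exists_quotient D s.2
    refine ⟨ψ, ⟨_, Θ.comp_mem_parahoricSections D hα hψ⟩, hψ, fun _ => rfl, e, ?_⟩
    rw [h]
    congr 1
    refine Subtype.ext (funext fun p => ?_)
    change Θ.Θ ((s.2.1 p)⁻¹ * t.2.1 p) = (Θ.Θ (ψ ⟨p.1, D.punct_le U p.2⟩))⁻¹
    rw [← map_inv, e]
    congr 1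
    rw [mul_inv_rev, inv_mul_cancel_right]

variable (hα : ∀ j t u, Commute (lieRpow t (α j)) (Θ.Θ u))
  (h : ∀ (U : Opens X) (l : LStar D a U) (φ : D.punct U → G), φ ∈ parahoricSections D α U ↔
    (fun p => Θ.Θ (l.1 p) * φ p * (Θ.Θ (l.1 p))⁻¹) ∈ parahoricSections D β U)

/-- The map from the presheaf quotient `ℰ × ℒ* / (𝒪*)ᵏ` to the twist of `ℰ`. -/
def TorusCoords.toTwist (ℰ : ParahoricBundle D α) :
    heckePresheaf Θ a ℰ ⟶ (Θ.heckeTwist hα h).famPresheaf ℰ where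
  app U := ↾(Quot.lift (fun s => (Θ.heckeTwist hα h).pure s.1 s.2) (by
    rintro s t hst
    have e : t.1 = ℰ.act s.1 ((Θ.heckeTwist hα h).trans s.2 t.2) :=
      (heckeRel_iff Θ hα ℰ s t).1 hst
    exact ((congrArg (fun q => (Θ.heckeTwist hα h).pure (E := ℰ) q t.2) e).trans
      ((Θ.heckeTwist hα h).pure_act_trans (E := ℰ) s.1 s.2 t.2)).symm))
  naturality U V i := by
    ext s
    induction s using Quot.ind with | mk s => ?_
    refine SheafTorsor.Twist.Fam.ext (funext fun W => funext fun hW => funext fun l => ?_)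
    exact congrArg (fun q => ℰ.act q _) (ℰ.res_res i.unop.le hW s.1)

/-- The map from the presheaf quotient to the twist becomes an isomorphism after
sheafification: it is injective, and surjective over open sets on which `ℒ*` has a section. -/
theorem TorusCoords.W_toTwist (ℰ : ParahoricBundle D α) :
    (Opens.grothendieckTopology X).W (Θ.toTwist hα h ℰ) := by
  rw [GrothendieckTopology.W_iff_isLocallyBijective]
  constructor
  · refine Presheaf.isLocallyInjective_of_injective _ _ fun U s t hst => ?_
    induction s using Quot.ind with | mk s => ?_
    induction t using Quot.ind with | mk t => ?_
    refine Quot.sound ((heckeRel_iff Θ hα ℰ s t).2 ?_)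
    exact (Θ.heckeTwist hα h).eq_of_pure_eq (E := ℰ) hst
  · refine ⟨fun {U} s x hx => ?_⟩
    obtain ⟨V, hV, hxV, ⟨l⟩⟩ := (Θ.heckeTwist hα h).exists_le hx
    refine ⟨V, homOfLE hV, ⟨Quot.mk _ (s.val V hV l, l), ?_⟩, hxV⟩
    exact (Θ.heckeTwist hα h).pure_val_self
      ((Θ.heckeTwist hα h).famPresheaf ℰ |>.map (homOfLE hV).op s) l

/-- The sheaf `ℰ ⊗ ℒ*` maps to the twist of `ℰ`, naturally in `ℰ`. -/
def TorusCoords.heckeSheafHom :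
    heckeSheaf Θ a ⟶ (Θ.heckeTwist hα h).functor ⋙ SheafTorsor.forget (parahoricSheaf D β) where
  app ℰ := ⟨sheafifyLift _ (Θ.toTwist hα h ℰ) ((Θ.heckeTwist hα h).famPresheaf_isSheaf ℰ)⟩
  naturality ℰ ℱ f := by
    have e : (heckePresheafFunctor Θ a).map f ≫ Θ.toTwist hα h ℱ
        = Θ.toTwist hα h ℰ ≫ (SheafTorsor.Hom.map ((Θ.heckeTwist hα h).functor.map f)).hom := by
      ext U s
      induction s using Quot.ind with | mk s => ?_
      exact ((Θ.heckeTwist hα h).famMap_pure f s.1 s.2).symm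
    exact Sheaf.hom_ext (sheafifyMap_sheafifyLift_comm ((Θ.heckeTwist hα h).famPresheaf_isSheaf ℰ)
      ((Θ.heckeTwist hα h).famPresheaf_isSheaf ℱ) e)

theorem TorusCoords.isIso_heckeSheafHom : IsIso (Θ.heckeSheafHom hα h) := by
  have : ∀ ℰ, IsIso ((Θ.heckeSheafHom hα h).app ℰ) := fun ℰ => by
    refine ((Opens.grothendieckTopology X).W_sheafToPresheaf_map_iff_isIso _).1 ?_
    refine MorphismProperty.of_precomp _ (toSheafify _ (heckePresheaf Θ a ℰ)) _
      (GrothendieckTopology.W_toSheafify _ _) ?_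
    have e : toSheafify _ (heckePresheaf Θ a ℰ) ≫ sheafifyLift _ (Θ.toTwist hα h ℰ)
      ((Θ.heckeTwist hα h).famPresheaf_isSheaf ℰ) = Θ.toTwist hα h ℰ :=
        toSheafify_sheafifyLift _ _ _
    exact e ▸ Θ.W_toTwist hα h ℰ
  exact NatIso.isIso_of_isIso_app _

theorem TorusCoords.heckeSheafHom_tmul (ℰ : ParahoricBundle D α) {U : Opens X}
    (ε : ℰ.sheaf.presheaf.obj (op U)) (l : LStar D a U) :
    ((Θ.heckeSheafHom hα h).app ℰ).hom.app (op U) (tmul Θ ℰ ε l)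
      = (Θ.heckeTwist hα h).pure (E := ℰ) ε l := by
  have e : toSheafify _ (heckePresheaf Θ a ℰ) ≫ sheafifyLift _ (Θ.toTwist hα h ℰ)
      ((Θ.heckeTwist hα h).famPresheaf_isSheaf ℰ) = Θ.toTwist hα h ℰ :=
        toSheafify_sheafifyLift _ _ _
  exact congrArg (fun q => q.app (op U) (Quot.mk _ (ε, l))) e

/-- The Hecke transformation given by the twist. -/
def TorusCoords.heckeTransformation : HeckeTransformation D Θ a α β where
  functor := (Θ.heckeTwist hα h).functor
  iso := haveI := Θ.isIso_heckeSheafHom hα h; (asIso (Θ.heckeSheafHom hα h)).symm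
  act_tmul ℰ U ε l φ μ hμ := by
    change (Θ.heckeTwist hα h).famAct
        (((Θ.heckeSheafHom hα h).app ℰ).hom.app (op U) (tmul Θ ℰ ε l)) μ
      = ((Θ.heckeSheafHom hα h).app ℰ).hom.app (op U) (tmul Θ ℰ (ℰ.act ε φ) l)
    rw [Θ.heckeSheafHom_tmul hα h, Θ.heckeSheafHom_tmul hα h]
    have e : μ = (Θ.heckeTwist hα h).conj l φ := Subtype.ext (funext hμ)
    exact (congrArg (fun q => (Θ.heckeTwist hα h).famAct ((Θ.heckeTwist hα h).pure (E := ℰ) ε l) q)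
      e).trans ((Θ.heckeTwist hα h).famAct_pure (E := ℰ) ε l φ)

/-- Sections of `ℰ ⊗ ℒ*` are locally of the form `ε ⊗ l`. -/
theorem exists_tmul (ℰ : ParahoricBundle D α) {U : Opens X}
    (s : ((heckeSheaf Θ a).obj ℰ).presheaf.obj (op U)) {x : X} (hx : x ∈ U) :
    ∃ (V : Opens X) (hV : V ≤ U) (ε : ℰ.sheaf.presheaf.obj (op V)) (l : LStar D a V),
      x ∈ V ∧ ((heckeSheaf Θ a).obj ℰ).presheaf.map (homOfLE hV).op s = tmul Θ ℰ ε l := by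
  obtain ⟨V, i, ⟨q, hq⟩, hxV⟩ := Presheaf.imageSieve_mem (Opens.grothendieckTopology X)
    (toSheafify (Opens.grothendieckTopology X) (heckePresheaf Θ a ℰ)) (U := op U) s x hx
  induction q using Quot.ind with | mk q => ?_
  exact ⟨V, i.le, q.1, q.2, hxV, hq.symm⟩

include h in
/-- The torsor structure on `ℰ ⊗ ℒ*` is determined by its values on the sections `ε ⊗ l`. -/
theorem HeckeTransformation.equivariant (σ τ : HeckeTransformation D Θ a α β)
    (ℰ : ParahoricBundle D α) {U : Opens X} (s : (σ.functor.obj ℰ).Sec U)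
    (μ : parahoricSections D β U) :
    (σ.iso.hom.app ℰ ≫ τ.iso.inv.app ℰ).hom.app (op U) ((σ.functor.obj ℰ).act s μ)
      = (τ.functor.obj ℰ).act ((σ.iso.hom.app ℰ ≫ τ.iso.inv.app ℰ).hom.app (op U) s) μ := by
  refine SheafTorsor.equivariant_of_local (E := σ.functor.obj ℰ) (F := τ.functor.obj ℰ)
    (σ.iso.hom.app ℰ ≫ τ.iso.inv.app ℰ) (fun {U} s μ x hx => ?_) s μ
  obtain ⟨V, hV, ε, l, hxV, e⟩ := exists_tmul Θ ℰ ((σ.iso.hom.app ℰ).hom.app (op U) s) hx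
  refine ⟨V, hV, hxV, ?_⟩
  have e1 : (σ.iso.hom.app ℰ).hom.app (op V) ((σ.functor.obj ℰ).res hV s) = tmul Θ ℰ ε l :=
    (NatTrans.naturality_apply (σ.iso.hom.app ℰ).hom (homOfLE hV).op s).trans e
  have cancel : ∀ t, (σ.iso.inv.app ℰ).hom.app (op V) ((σ.iso.hom.app ℰ).hom.app (op V) t) = t :=
    fun t => congrArg (fun q => q.hom.app (op V) t) (σ.iso.hom_inv_id_app ℰ)
  have cancel' : ∀ t, (σ.iso.hom.app ℰ ≫ τ.iso.inv.app ℰ).hom.app (op V)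
      ((σ.iso.inv.app ℰ).hom.app (op V) t) = (τ.iso.inv.app ℰ).hom.app (op V) t :=
    fun t => congrArg (fun q => (τ.iso.inv.app ℰ).hom.app (op V) (q.hom.app (op V) t))
      (σ.iso.inv_hom_id_app ℰ)
  have e2 : (σ.functor.obj ℰ).res hV s = (σ.iso.inv.app ℰ).hom.app (op V) (tmul Θ ℰ ε l) := by
    rw [← e1]
    exact (cancel _).symm
  let φ := (Θ.conjEquiv l (h V l)).symm (SheafTorsor.gres (parahoricSheaf D β) hV μ)
  have hφ : ∀ p, (SheafTorsor.gres (parahoricSheaf D β) hV μ).1 p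
      = Θ.Θ (l.1 p) * φ.1 p * (Θ.Θ (l.1 p))⁻¹ := fun p =>
    congrArg (fun q => q.1 p) ((Θ.conjEquiv l (h V l)).apply_symm_apply
      (SheafTorsor.gres (parahoricSheaf D β) hV μ)).symm
  rw [e2]
  refine (congrArg _ (σ.act_tmul ℰ V ε l φ _ hφ)).trans ?_
  refine (cancel' _).trans ((τ.act_tmul ℰ V ε l φ _ hφ).symm.trans ?_)
  exact congrArg (fun q => (τ.functor.obj ℰ).act q _) (cancel' _).symm

include h in
/-- Any two Hecke transformations are isomorphic. -/
theorem HeckeTransformation.nonempty_iso (σ τ : HeckeTransformation D Θ a α β) :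
    Nonempty (σ.functor ≅ τ.functor) := by
  let ν : σ.functor ⟶ τ.functor :=
    { app := fun ℰ => ⟨σ.iso.hom.app ℰ ≫ τ.iso.inv.app ℰ, fun s μ =>
        HeckeTransformation.equivariant Θ h σ τ ℰ s μ⟩
      naturality := fun ℰ ℱ f =>
        SheafTorsor.Hom.ext ((σ.iso.hom ≫ τ.iso.inv).naturality f) }
  have : ∀ ℰ, IsIso (ν.app ℰ) := fun ℰ => SheafTorsor.Hom.isIso _
  have := NatIso.isIso_of_isIso_app ν
  exact ⟨asIso ν⟩

include hα h in
theorem HeckeTransformation.isEquivalence (τ : HeckeTransformation D Θ a α β) :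
    τ.functor.IsEquivalence := by
  obtain ⟨e⟩ := HeckeTransformation.nonempty_iso Θ h (Θ.heckeTransformation hα h) τ
  have : (Θ.heckeTransformation hα h).functor.IsEquivalence :=
    (Θ.heckeTwist hα h).functor_isEquivalence
  exact Functor.isEquivalence_of_iso e

end Hecke

end Parahoric

end

theorem mainTheorem10
    {X : Type u} [TopologicalSpace X] [T2Space X] [CompactSpace X] [ConnectedSpace X]
    [ChartedSpace ℂ X] [IsManifold 𝓘(ℂ, ℂ) ω X] {r : ℕ} (D : Parahoric.Marking X r)
    {E : Type*} [NormedAddCommGroup E] [NormedSpace ℂ E] [FiniteDimensional ℂ E]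
    {G : Type u} [Group G] [TopologicalSpace G] [T2Space G] [ChartedSpace E G]
    [LieGroup 𝓘(ℂ, E) ω G]
    (H T : Subgroup G) (hH : Parahoric.IsReductivePair E H) (hT : Parahoric.IsMaximalTorus H T)
    {k : ℕ} (Θ : Parahoric.TorusCoords E T k)
    (α lam : Fin r → GroupLieAlgebra 𝓘(ℂ, E) G)
    (hα : ∀ j, α j ∈ Parahoric.imSubLie E T)
    (hlam : ∀ j, lam j ∈ Parahoric.imSubLie E T)
    (hcochar : ∀ j, (2 * Real.pi * Complex.I : ℂ) • lam j ∈ Parahoric.cocharLattice E T) :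
    (∃! a : Fin r → Fin k → ℤ,
      ∀ j, lam j = ∑ i, (Complex.I / (2 * Real.pi) * (a j i : ℂ)) • Θ.chi i) ∧
    ∀ a : Fin r → Fin k → ℤ,
      (∀ j, lam j = ∑ i, (Complex.I / (2 * Real.pi) * (a j i : ℂ)) • Θ.chi i) →
      (∀ (U : Opens X) (l : Parahoric.LStar D a U) (φ : D.punct U → G),
        φ ∈ Parahoric.parahoricSections D α U ↔
          (fun p => Θ.Θ (l.1 p) * φ p * (Θ.Θ (l.1 p))⁻¹) ∈
            Parahoric.parahoricSections D (α + lam) U) ∧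
      Nonempty (Parahoric.HeckeTransformation D Θ a α (α + lam)) ∧
      ∀ τ : Parahoric.HeckeTransformation D Θ a α (α + lam), τ.functor.IsEquivalence := by
  have hconj : ∀ a : Fin r → Fin k → ℤ,
      (∀ j, lam j = ∑ i, (Complex.I / (2 * Real.pi) * (a j i : ℂ)) • Θ.chi i) →
      ∀ (U : Opens X) (l : Parahoric.LStar D a U) (φ : D.punct U → G),
        φ ∈ Parahoric.parahoricSections D α U ↔
          (fun p => Θ.Θ (l.1 p) * φ p * (Θ.Θ (l.1 p))⁻¹) ∈
            Parahoric.parahoricSections D (α + lam) U :=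
    fun a ha U l φ => Θ.conj_mem_iff D hT.comm hα ha l φ
  have hcomm : ∀ j t u, Commute (Parahoric.lieRpow t (α j)) (Θ.Θ u) :=
    fun j t u => Θ.commute_lieRpow hT.comm (hα j) t u
  refine ⟨?_, fun a ha => ⟨hconj a ha, ⟨Θ.heckeTransformation hcomm (hconj a ha)⟩,
    fun τ => τ.isEquivalence Θ hcomm (hconj a ha)⟩⟩
  choose a ha hu using fun j => Θ.existsUnique_coeff (hcochar j)
  exact ⟨a, ha, fun b hb => funext fun j => hu j (b j) (hb j)⟩
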